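/- **Setting.** Let $d\ge 1$. Fix a compactly supported, continuous Cohen–Daubechies–Vial type orthonormal wavelet basis of $L^2([0,1])$ of regularity $S$: from a level $J_0\ge1$ on (with $2^{J_0}\ge S$ and $2^{J_0}\ge 2N$, where the scaling function and the wavelet are supported in $[1-N,N]$), level $j$ has $2^j$ scaling functions $\phi_{jm}$ and $2^j$ wavelets $\psi_{jm}$, which are the dilated translates $2^{j/2}\phi(2^jx-m)$, $2^{j/2}\psi(2^jx-m)$ except for $N$ dilated compactly supported edge functions at each end point; they form an orthonormal multiresolution analysis of $L^2([0,1])$ whose levels contain all polynomials of degree at most $S-1$. On $[0,1]^d$ put $\Phi_{jm}(x)=\prod_i\phi_{jm_i}(x_i)$, and let $\Psi^{\iota}_{lm}$ ($\iota\in\{0,1\}^d\setminus\{0\}$) be the product whose $i$-th factor is $\psi_{lm_i}$ if $\iota_i=1$ and $\phi_{lm_i}$ if $\iota_i=0$. For $k=2^{jd}$, $j\ge J_0$, let $K_{V_k}(x,y)=\sum_m\Phi_{jm}(x)\Phi_{jm}(y)$. For $\alpha>0$ let $$\|h\|_{\alpha}=2^{J_0(\alpha+d/2)}\max_m|\langle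 h,\Phi_{J_0m}\rangle|+\sup_{l\ge J_0,m,\iota}2^{l(\alpha+d/2)}|\langle h,\Psi^{\iota}_{lm}\rangle|$$ and let $H(\alpha,M)$ be the set of continuous $h$ on $[0,1]^d$ with $\|h\|_\alpha\le M$. Let $0<\alpha,\beta<S$, $M>0$, $C_1,C_2\in\mathbb R$. Let $\mathcal P(C_1,C_2,M)$ be the set of laws $\mathbb P$ of $(X,A,Y)$ such that $X$ is uniform on $[0,1]^d$, $A,Y\in[C_1,C_2]$ almost surely, $p(x)=\mathbb E_{\mathbb P}[A\mid X=x]$ is in $H(\alpha,M)$ and $b(x)=\mathbb E_{\mathbb P}[Y\mid X=x]$ is in $H(\beta,M)$. Let $\psi(\mathbb P)=\mathbb E_{\mathbb P}[\mathrm{Cov}_{\mathbb P}(A,Y\mid X)]$. From an i.i.d. sample $(X_i,A_i,Y_i)_{i\le n}$ of $\mathbb P$ form, without sample splitting, the Newey–Robins plug-in estimator $$\hat\psi^{\mathrm{NR}}_k=\frac1n\sum_{i=1}^nA_i\bigl(Y_i-\hat b_k(X_i)\bigr),\qquad \hat b_k(x)=\frac1n\sum_{i=1}^nY_iK_{V_k}(X_i,x).$$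 **Theorem 5.** There is a constant $C>0$, depending only on $d,\alpha,\beta,M,C_1,C_2$ and the wavelet basis, such that for all $n\ge1$ and all $k=2^{jd}$ with $j\ge J_0$ the estimator is square integrable under every $\mathbb P\in\mathcal P(C_1,C_2,M)$ and $$\sup_{\mathbb P\in\mathcal P(C_1,C_2,M)}\bigl|\mathbb E_{\mathbb P}(\hat\psi^{\mathrm{NR}}_k-\psi(\mathbb P))\bigr|\le C\Bigl(k^{-(\alpha+\beta)/d}\vee\frac kn\Bigr),\qquad \sup_{\mathbb P\in\mathcal P(C_1,C_2,M)}\mathrm{Var}_{\mathbb P}(\hat\psi^{\mathrm{NR}}_k)\le C\Bigl(\frac1n+\frac k{n^2}+\frac{k^2}{n^3}\Bigr).$$ If moreover the model is not degenerate, in the sense that $\mathcal P(C_1',C_2',M')$ is non-empty for some $C_1'>C_1$, $C_2'<C_2$, $M'<M$ (this holds, for instance, whenever $C_1<0<C_2$), then there is a constant $c>0$, depending on the same quantities only, such that for all such $n$ and $k$ $$\sup_{\mathbb P\in\mathcal P(C_1,C_2,M)}\bigl|\mathbb E_{\mathbb P}(\hat\psi^{\mathrm{NR}}_k-\psi(\mathbb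 P))\bigr|\ge c\Bigl(k^{-(\alpha+\beta)/d}\vee\frac kn\Bigr).$$ That is, the worst-case bias is of exact order $k^{-(\alpha+\beta)/d}\vee k/n$. -/

import Mathlib

open MeasureTheory ProbabilityTheory Set
open scoped ENNReal

noncomputable section

/-- The functions at level `j` of a boundary-corrected system on `[0,1]`, indexed by
`m = 0, …, 2^j - 1`.  The `N` first indices are dilates of the left edge functions, the `N` last
ones are dilates, moved to the end point `1`, of the right edge functions, and the others are
the dilated translates `2^(j/2) g (2^j x - m)` of one function `g`. -/
def intervalAtom (N : ℕ) (left : ℕ → ℝ → ℝ) (g : ℝ → ℝ) (right : ℕ → ℝ → ℝ)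
    (j : ℕ) (m : Fin (2 ^ j)) (x : ℝ) : ℝ :=
  (2 : ℝ) ^ ((j : ℝ) / 2) *
    (if (m : ℕ) < N then left m ((2 : ℝ) ^ j * x)
     else if 2 ^ j ≤ (m : ℕ) + N then right (2 ^ j - 1 - (m : ℕ)) ((2 : ℝ) ^ j * (x - 1))
     else g ((2 : ℝ) ^ j * x - (m : ℝ)))

/-- A (continuous) compactly supported orthonormal wavelet basis of `L²([0,1])` of
Cohen–Daubechies–Vial type, of regularity `S`: a scaling function `φ` and a wavelet `ψ` with
support in `[1-N, N]`, together with `N` compactly supported edge functions of each kind at each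
end point, whose dilates and translates form an orthonormal multiresolution analysis of
`L²([0,1])`, starting at level `J₀`, that reproduces the polynomials of degree at most `S - 1`. -/
structure CDVBasis (S : ℕ) where
  /-- support parameter, and number of edge functions at each end point -/
  N : ℕ
  /-- coarsest level -/
  J₀ : ℕ
  /-- bound on the supports of the edge functions -/
  R : ℝ
  /-- scaling function -/
  φ : ℝ → ℝ
  /-- wavelet -/
  ψ : ℝ → ℝ
  /-- left edge scaling functions, those with index `r < N` being used, on `[0, ∞)` only -/
  φLeft : ℕ → ℝ → ℝ
  /-- right edge scaling functions, those with index `r < N` being used, on `(-∞, 0]` only -/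
  φRight : ℕ → ℝ → ℝ
  /-- left edge wavelets -/
  ψLeft : ℕ → ℝ → ℝ
  /-- right edge wavelets -/
  ψRight : ℕ → ℝ → ℝ
  one_le_J₀ : 1 ≤ J₀
  regularity_le : S ≤ 2 ^ J₀
  two_mul_N_le : 2 * N ≤ 2 ^ J₀
  continuous_φ : Continuous φ
  continuous_ψ : Continuous ψ
  /- The values of left (right) edge functions on the negative (positive) half line are never
  used; they are taken to be any continuous extension. -/
  continuous_φLeft : ∀ r < N, Continuous (φLeft r)
  continuous_φRight : ∀ r < N, Continuous (φRight r)
  continuous_ψLeft : ∀ r < N, Continuous (ψLeft r)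
  continuous_ψRight : ∀ r < N, Continuous (ψRight r)
  support_φ : Function.support φ ⊆ Icc (1 - (N : ℝ)) N
  support_ψ : Function.support ψ ⊆ Icc (1 - (N : ℝ)) N
  support_φLeft : ∀ r < N, ∀ x, R < x → φLeft r x = 0
  support_φRight : ∀ r < N, ∀ x, x < -R → φRight r x = 0
  support_ψLeft : ∀ r < N, ∀ x, R < x → ψLeft r x = 0
  support_ψRight : ∀ r < N, ∀ x, x < -R → ψRight r x = 0
  /-- At each level the scaling functions are orthonormal in `L²([0,1])`, -/
  orthonormal_φ : ∀ j, J₀ ≤ j → ∀ m m' : Fin (2 ^ j),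
    ∫ x in Icc (0 : ℝ) 1, intervalAtom N φLeft φ φRight j m x *
      intervalAtom N φLeft φ φRight j m' x = if m = m' then 1 else 0
  /-- the wavelets are orthonormal, -/
  orthonormal_ψ : ∀ j, J₀ ≤ j → ∀ m m' : Fin (2 ^ j),
    ∫ x in Icc (0 : ℝ) 1, intervalAtom N ψLeft ψ ψRight j m x *
      intervalAtom N ψLeft ψ ψRight j m' x = if m = m' then 1 else 0
  /-- and the former are orthogonal to the latter. -/
  orthogonal_φ_ψ : ∀ j, J₀ ≤ j → ∀ m m' : Fin (2 ^ j),
    ∫ x in Icc (0 : ℝ) 1, intervalAtom N φLeft φ φRight j m x *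
      intervalAtom N ψLeft ψ ψRight j m' x = 0
  /-- Multiresolution: the scaling functions of level `j` are in the span of those of
  level `j + 1`, -/
  refine_φ : ∀ j, J₀ ≤ j → ∀ m : Fin (2 ^ j), ∃ c : Fin (2 ^ (j + 1)) → ℝ,
    ∀ x ∈ Icc (0 : ℝ) 1, intervalAtom N φLeft φ φRight j m x =
      ∑ i, c i * intervalAtom N φLeft φ φRight (j + 1) i x
  /-- and so are the wavelets of level `j`. -/
  refine_ψ : ∀ j, J₀ ≤ j → ∀ m : Fin (2 ^ j), ∃ c : Fin (2 ^ (j + 1)) → ℝ,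
    ∀ x ∈ Icc (0 : ℝ) 1, intervalAtom N ψLeft ψ ψRight j m x =
      ∑ i, c i * intervalAtom N φLeft φ φRight (j + 1) i x
  /-- The system is complete in `L²([0,1])`. -/
  complete : ∀ f : ℝ → ℝ, MemLp f 2 (volume.restrict (Icc (0 : ℝ) 1)) →
    (∀ m, ∫ x in Icc (0 : ℝ) 1, f x * intervalAtom N φLeft φ φRight J₀ m x = 0) →
    (∀ l, J₀ ≤ l → ∀ m, ∫ x in Icc (0 : ℝ) 1, f x * intervalAtom N ψLeft ψ ψRight l m x = 0) →
    f =ᵐ[volume.restrict (Icc (0 : ℝ) 1)] 0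
  /-- Regularity: each level reproduces the polynomials of degree at most `S - 1`. -/
  polynomials : ∀ j, J₀ ≤ j → ∀ r < S, ∃ c : Fin (2 ^ j) → ℝ,
    ∀ x ∈ Icc (0 : ℝ) 1, x ^ r = ∑ m, c m * intervalAtom N φLeft φ φRight j m x

/-- The unit cube `[0,1]^d`. -/
def cube (d : ℕ) : Set (Fin d → ℝ) := Icc 0 1

namespace CDVBasis

variable {S : ℕ} (W : CDVBasis S) {d : ℕ}

/-- The one-dimensional scaling function `φ_{j m}` on `[0,1]`. -/
def scaling (j : ℕ) (m : Fin (2 ^ j)) : ℝ → ℝ := intervalAtom W.N W.φLeft W.φ W.φRight j m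

/-- The one-dimensional wavelet `ψ_{j m}` on `[0,1]`. -/
def wavelet (j : ℕ) (m : Fin (2 ^ j)) : ℝ → ℝ := intervalAtom W.N W.ψLeft W.ψ W.ψRight j m

/-- The tensor scaling function `Φ_{j m}` on `[0,1]^d`. -/
def Phi (j : ℕ) (m : Fin d → Fin (2 ^ j)) (x : Fin d → ℝ) : ℝ :=
  ∏ i, W.scaling j (m i) (x i)

/-- The tensor wavelet `Ψ^ι_{l m}` on `[0,1]^d` (`ι i = true` selects the wavelet in the `i`-th
coordinate, `ι i = false` the scaling function). -/
def Psi (ι : Fin d → Bool) (l : ℕ) (m : Fin d → Fin (2 ^ l)) (x : Fin d → ℝ) : ℝ :=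
  ∏ i, if ι i then W.wavelet l (m i) (x i) else W.scaling l (m i) (x i)

/-- The kernel `K_{V_k}(x, y)`, `k = 2^(j d)`, of the orthogonal projection of `L²([0,1]^d)` onto
the span of the `Φ_{j m}`. -/
def kernel (j : ℕ) (x y : Fin d → ℝ) : ℝ :=
  ∑ m : Fin d → Fin (2 ^ j), W.Phi j m x * W.Phi j m y

/-- The Hölder (Besov `B^α_{∞∞}`) norm of a function on `[0,1]^d`, through its wavelet
coefficients. -/
def holderNorm (α : ℝ) (h : (Fin d → ℝ) → ℝ) : ℝ≥0∞ :=
  (⨆ m : Fin d → Fin (2 ^ W.J₀), ENNReal.ofReal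
      ((2 : ℝ) ^ ((W.J₀ : ℝ) * (α + d / 2)) * |∫ x in cube d, h x * W.Phi W.J₀ m x|)) +
  ⨆ (l : ℕ) (_ : W.J₀ ≤ l) (m : Fin d → Fin (2 ^ l)) (ι : Fin d → Bool)
    (_ : ι ≠ fun _ => false), ENNReal.ofReal
      ((2 : ℝ) ^ ((l : ℝ) * (α + d / 2)) * |∫ x in cube d, h x * W.Psi ι l m x|)

/-- The Hölder ball `H(α, M)` of (uniformly) continuous functions on the compact cube. -/
def holderBall (d : ℕ) (α M : ℝ) : Set ((Fin d → ℝ) → ℝ) :=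
  {h | ContinuousOn h (cube d) ∧ W.holderNorm α h ≤ ENNReal.ofReal M}

end CDVBasis

/-- An observation `(X, A, Y)`. -/
abbrev Obs (d : ℕ) : Type := (Fin d → ℝ) × ℝ × ℝ

/-- covariates -/
def obsX {d : ℕ} (o : Obs d) : Fin d → ℝ := o.1

/-- treatment -/
def obsA {d : ℕ} (o : Obs d) : ℝ := o.2.1

/-- outcome -/
def obsY {d : ℕ} (o : Obs d) : ℝ := o.2.2

/-- The σ-algebra generated by `X`. -/
abbrev sigmaX (d : ℕ) : MeasurableSpace (Obs d) := MeasurableSpace.comap obsX inferInstance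

/-- The model: laws of `(X, A, Y)` with `X` uniform on `[0,1]^d`, `A, Y ∈ [C₁, C₂]` a.s., and
regression functions `p(x) = E[A | X = x] ∈ H(α, M)`, `b(x) = E[Y | X = x] ∈ H(β, M)`. -/
structure IsModelLaw {S d : ℕ} (W : CDVBasis S) (α β M C₁ C₂ : ℝ) (P : Measure (Obs d)) :
    Prop where
  isProbabilityMeasure : IsProbabilityMeasure P
  uniform : P.map obsX = volume.restrict (cube d)
  bounded_A : ∀ᵐ o ∂P, obsA o ∈ Icc C₁ C₂
  bounded_Y : ∀ᵐ o ∂P, obsY o ∈ Icc C₁ C₂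
  holder_p : ∃ p ∈ W.holderBall d α M, P[obsA | sigmaX d] =ᵐ[P] fun o => p (obsX o)
  holder_b : ∃ b ∈ W.holderBall d β M, P[obsY | sigmaX d] =ᵐ[P] fun o => b (obsX o)

/-- The functional `ψ(P) = E_P[Cov_P(A, Y | X)]`. -/
def expCondCov {d : ℕ} (P : Measure (Obs d)) : ℝ :=
  ∫ o, (P[fun o' => (obsA o' - (P[obsA | sigmaX d]) o') * (obsY o' - (P[obsY | sigmaX d]) o')
    | sigmaX d]) o ∂P

/-- The law of an i.i.d. sample of size `n` from `P`. -/
def sampleLaw {d : ℕ} (n : ℕ) (P : Measure (Obs d)) : Measure (Fin n → Obs d) :=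
  Measure.pi fun _ => P

/-- The approximate wavelet projection estimator of `b` with resolution `k = 2^(j d)`. -/
def bHat {S d : ℕ} (W : CDVBasis S) (j : ℕ) {n : ℕ} (D : Fin n → Obs d) (x : Fin d → ℝ) : ℝ :=
  (1 / (n : ℝ)) * ∑ i, obsY (D i) * W.kernel j (obsX (D i)) x

/-- The Newey–Robins plug-in estimator with resolution `k = 2^(j d)` without sample splitting:
`b` is estimated from the same sample. -/
def psiNR {S d : ℕ} (W : CDVBasis S) (j : ℕ) {n : ℕ} (D : Fin n → Obs d) : ℝ :=
  (1 / (n : ℝ)) * ∑ i, obsA (D i) * (obsY (D i) - bHat W j D (obsX (D i)))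

/-- `sup_P |E_P(ψ̂ - ψ(P))|` over the model. -/
def supBiasNR {S : ℕ} (W : CDVBasis S) (d : ℕ) (α β M C₁ C₂ : ℝ) (n j : ℕ) : ℝ≥0∞ :=
  ⨆ (P : Measure (Obs d)) (_ : IsModelLaw W α β M C₁ C₂ P),
    ENNReal.ofReal |∫ D, (psiNR W j D - expCondCov P) ∂(sampleLaw n P)|

/-- `sup_P Var_P(ψ̂)` over the model. -/
def supVarNR {S : ℕ} (W : CDVBasis S) (d : ℕ) (α β M C₁ C₂ : ℝ) (n j : ℕ) : ℝ≥0∞ :=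
  ⨆ (P : Measure (Obs d)) (_ : IsModelLaw W α β M C₁ C₂ P),
    evariance (fun D => psiNR W j D) (sampleLaw n P)

/-- The resolution `k = 2^(j d)`. -/
def resolution (d j : ℕ) : ℝ := (2 : ℝ) ^ (j * d)

/-- `k^(-(α+β)/d) ∨ k/n`. -/
def biasRate (d : ℕ) (α β : ℝ) (n j : ℕ) : ℝ :=
  max (resolution d j ^ (-(α + β) / (d : ℝ))) (resolution d j / n)

/-- `1/n + k/n² + k²/n³`. -/
def varRate (d n j : ℕ) : ℝ :=
  1 / (n : ℝ) + resolution d j / (n : ℝ) ^ 2 + resolution d j ^ 2 / (n : ℝ) ^ 3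

end

/-!
The Newey–Robins estimator is the average over all `n ^ 2` pairs of observations, diagonal
included, of `A_i (Y_i - Y_l K(X_l, X_i))` (`psiNR_eq_sum_pairTerm`).

*Bias.* Off the diagonal the two observations are independent, so that `A` and `Y` may be replaced
by the regression functions `p` and `b`; on the diagonal this is not so. Hence
(`RegressionLaw.integral_psiNR_sub`) the bias is the approximation error `⟨p - Πp, b - Πb⟩` of the
projection `Π` onto `V_k`, minus `1 / n` times `E[A Y K(X, X)] - ⟨Πp, Πb⟩`. The second part is at
most of order `k / n` since `K(x, x)` is at most of order `k` and the kernels are bounded in `L¹`.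
For the first one, the orthonormal systems `φ_j ∪ ψ_j` and `φ_{j+1}` have the same cardinality and
the former is in the span of the latter, which gives the two-scale identity for the kernels
(`CDVBasis.kernel_succ`); the increments of the projections of a function of smoothness `α` are
therefore of order `2 ^ (-jα)` uniformly. The projections of a continuous function converge to it,
because the kernels are localized at the diagonal and reproduce the constants
(`CDVBasis.tendsto_proj`). Summing a geometric series bounds `p - Πp` in the uniform norm, and the
product of the two residuals gives `k ^ (-(α + β) / d)`.

*Variance.* Covariances of pairs of observations without a common index vanish. For pairs that
share an index, the moments are bounded by `1`, up to a factor `k` for every further coincidence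
among the indices, as `K` is bounded by a multiple of `k` and its averages over one argument are
bounded (`BoundedPairKernel.covariance_le`). Counting indices gives `1 / n + k / n² + k² / n³`.

*Lower bound for the bias.* Non-degeneracy leaves room for perturbations around some `p`, `b`. Two
laws with these regression functions and conditional covariances `± ε²` have biases that differ by
`2 ε² k / n`. This settles the case that `k / n` exceeds a constant. Otherwise, `p` and `b` are
perturbed by `± a` and `± a'` times the sum `u` of the wavelets of level `j`, which is orthogonal
to `V_k`; the mean of the four biases, weighted by the product of the signs, is
`a a' ∫ u² (1 - K(x, x) / n)`, of order `k ^ (-(α + β) / d)`.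
-/

/-! ### Boundary-corrected systems on the unit interval -/

section Atom

variable {N : ℕ} {left right : ℕ → ℝ → ℝ} {g : ℝ → ℝ}

lemma continuous_intervalAtom (hl : ∀ r < N, Continuous (left r)) (hg : Continuous g)
    (hr : ∀ r < N, Continuous (right r)) (j : ℕ) (m : Fin (2 ^ j)) :
    Continuous (intervalAtom N left g right j m) := by
  unfold intervalAtom
  refine continuous_const.mul ?_
  split_ifs with h1 h2
  · exact (hl _ h1).comp (by fun_prop)
  · exact (hr _ (by omega)).comp (by fun_prop)
  · exact hg.comp (by fun_prop)

/-- Finitely many continuous functions that vanish beyond `R` are uniformly bounded on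
`[0, ∞)`. -/
lemma exists_bound_of_eq_zero_of_lt {f : ℕ → ℝ → ℝ} {R : ℝ} (hf : ∀ r < N, Continuous (f r))
    (h0 : ∀ r < N, ∀ x, R < x → f r x = 0) :
    ∃ A, 0 ≤ A ∧ ∀ r < N, ∀ x, 0 ≤ x → |f r x| ≤ A := by
  have h : ∀ r, ∃ A, 0 ≤ A ∧ (r < N → ∀ x, 0 ≤ x → |f r x| ≤ A) := by
    intro r
    by_cases hr : r < N
    · obtain ⟨A, hA⟩ := isCompact_Icc (a := (0 : ℝ)) (b := R) |>.exists_bound_of_continuousOn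
        (hf r hr).continuousOn
      refine ⟨max A 0, le_max_right _ _, fun _ x hx => ?_⟩
      by_cases hxR : R < x
      · simp [h0 r hr x hxR]
      · exact (hA x ⟨hx, not_lt.mp hxR⟩).trans (le_max_left _ _)
    · exact ⟨0, le_rfl, fun h => absurd h hr⟩
  choose A hA0 hA using h
  refine ⟨∑ r ∈ Finset.range N, A r, Finset.sum_nonneg fun r _ => hA0 r, fun r hr x hx => ?_⟩
  exact (hA r hr x hx).trans
    (Finset.single_le_sum (fun r _ => hA0 r) (Finset.mem_range.mpr hr))

/-- Only `2 N` integer translates of a function supported in `[1 - N, N]` meet a given point. -/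
lemma card_translates_le (n : ℕ) (u : ℝ) :
    (Finset.univ.filter fun m : Fin n => u - (m : ℝ) ∈ Icc (1 - (N : ℝ)) N).card ≤ 2 * N := by
  have hinj : Function.Injective fun m : Fin n => ((m : ℕ) : ℤ) := fun a b h => by
    simpa [Fin.ext_iff] using h
  rw [← Finset.card_image_of_injective _ hinj]
  calc _ ≤ (Finset.Icc (⌈u - N⌉) (⌈u - N⌉ + 2 * N - 1)).card := by
        refine Finset.card_le_card fun z hz => ?_
        simp only [Finset.mem_image, Finset.mem_filter, Finset.mem_univ, true_and, mem_Icc] at hz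
        obtain ⟨m, ⟨h1, h2⟩, rfl⟩ := hz
        have h3 : ⌈u - N⌉ ≤ ((m : ℕ) : ℤ) := Int.ceil_le.mpr (by push_cast; linarith)
        have h4 : ((m : ℕ) : ℤ) ≤ ⌈u - N⌉ + 2 * N - 1 := by
          have h5 := Int.le_ceil (u - N)
          have : ((m : ℕ) : ℝ) ≤ (⌈u - N⌉ : ℝ) + 2 * N - 1 := by linarith
          exact_mod_cast this
        exact Finset.mem_Icc.mpr ⟨h3, h4⟩
    _ = 2 * N := by simp only [Int.card_Icc]; omega

/-- At level `j` a boundary-corrected system of bounded, compactly supported functions is of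
size `2 ^ (j / 2)`, even when summed over the translations. -/
lemma exists_sum_abs_intervalAtom_le {R : ℝ} (hl : ∀ r < N, Continuous (left r))
    (hg : Continuous g) (hr : ∀ r < N, Continuous (right r))
    (hl0 : ∀ r < N, ∀ x, R < x → left r x = 0) (hg0 : Function.support g ⊆ Icc (1 - (N : ℝ)) N)
    (hr0 : ∀ r < N, ∀ x, x < -R → right r x = 0) :
    ∃ A, 0 ≤ A ∧ ∀ j : ℕ, ∀ x ∈ Icc (0 : ℝ) 1,
      ∑ m, |intervalAtom N left g right j m x| ≤ A * (2 : ℝ) ^ ((j : ℝ) / 2) := by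
  obtain ⟨A₁, hA₁, h₁⟩ := exists_bound_of_eq_zero_of_lt hl hl0
  obtain ⟨A₂, hA₂, h₂⟩ := exists_bound_of_eq_zero_of_lt (f := fun r x => right r (-x))
    (fun r h => (hr r h).comp continuous_neg) (R := R) (fun r h x hx => hr0 r h _ (by linarith))
  obtain ⟨A₃, h₃⟩ := isCompact_Icc (a := 1 - (N : ℝ)) (b := N) |>.exists_bound_of_continuousOn
    hg.continuousOn
  have hA₃ : ∀ x, |g x| ≤ max A₃ 0 := by
    intro x
    by_cases hx : x ∈ Icc (1 - (N : ℝ)) N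
    · exact (h₃ x hx).trans (le_max_left _ _)
    · rw [Function.notMem_support.mp fun h => hx (hg0 h)]; simp
  refine ⟨N * A₁ + N * A₂ + (2 * N : ℕ) * max A₃ 0, by positivity, fun j x hx => ?_⟩
  have hpos : (0 : ℝ) < (2 : ℝ) ^ ((j : ℝ) / 2) := by positivity
  have hterm : ∀ m : Fin (2 ^ j), |intervalAtom N left g right j m x| ≤
      ((if (m : ℕ) < N then A₁ else 0) + (if 2 ^ j ≤ (m : ℕ) + N then A₂ else 0) +
        (if (2 : ℝ) ^ j * x - (m : ℝ) ∈ Icc (1 - (N : ℝ)) N then max A₃ 0 else 0)) *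
        (2 : ℝ) ^ ((j : ℝ) / 2) := by
    intro m
    rw [intervalAtom, abs_mul, abs_of_pos hpos, mul_comm]
    refine mul_le_mul_of_nonneg_right ?_ hpos.le
    have n1 : 0 ≤ if (m : ℕ) < N then A₁ else 0 := by split_ifs <;> simp [hA₁]
    have n2 : 0 ≤ if 2 ^ j ≤ (m : ℕ) + N then A₂ else 0 := by split_ifs <;> simp [hA₂]
    have n3 : 0 ≤ if (2 : ℝ) ^ j * x - (m : ℝ) ∈ Icc (1 - (N : ℝ)) N then max A₃ 0 else 0 := by
      split_ifs <;> simp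
    by_cases c1 : (m : ℕ) < N
    · rw [if_pos c1] at n1 ⊢
      have := h₁ m c1 ((2 : ℝ) ^ j * x) (mul_nonneg (by positivity) hx.1)
      rw [if_pos c1]; linarith
    by_cases c2 : 2 ^ j ≤ (m : ℕ) + N
    · have := h₂ (2 ^ j - 1 - m) (by omega) (-((2 : ℝ) ^ j * (x - 1)))
        (by have := hx.2
            have : 0 ≤ (2 : ℝ) ^ j * (1 - x) := mul_nonneg (by positivity) (by linarith)
            linarith)
      simp only [neg_neg] at this
      rw [if_pos c2] at n2
      rw [if_neg c1, if_neg c1, if_pos c2, if_pos c2]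
      linarith
    · rw [if_neg c1, if_neg c1, if_neg c2, if_neg c2]
      by_cases c3 : (2 : ℝ) ^ j * x - (m : ℝ) ∈ Icc (1 - (N : ℝ)) N
      · rw [if_pos c3]; linarith [hA₃ ((2 : ℝ) ^ j * x - m)]
      · rw [if_neg c3, Function.notMem_support.mp fun h => c3 (hg0 h)]; simp
  refine (Finset.sum_le_sum fun m _ => hterm m).trans ?_
  rw [← Finset.sum_mul]
  refine mul_le_mul_of_nonneg_right ?_ hpos.le
  rw [Finset.sum_add_distrib, Finset.sum_add_distrib]
  simp only [← Finset.sum_filter, Finset.sum_const, nsmul_eq_mul]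
  have k1 : (Finset.univ.filter fun m : Fin (2 ^ j) => (m : ℕ) < N).card ≤ N := by
    rw [← Finset.card_image_of_injective _ Fin.val_injective]
    refine (Finset.card_le_card (t := Finset.range N) fun z hz => ?_).trans (by simp)
    simp only [Finset.mem_image, Finset.mem_filter, Finset.mem_univ, true_and] at hz
    obtain ⟨m, h, rfl⟩ := hz
    simpa using h
  have k2 : (Finset.univ.filter fun m : Fin (2 ^ j) => 2 ^ j ≤ (m : ℕ) + N).card ≤ N := by
    rw [← Finset.card_image_of_injective _ Fin.val_injective]
    refine (Finset.card_le_card (t := Finset.Ico (2 ^ j - N) (2 ^ j)) fun z hz => ?_).trans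
      (by rw [Nat.card_Ico]; omega)
    simp only [Finset.mem_image, Finset.mem_filter, Finset.mem_univ, true_and] at hz
    obtain ⟨m, h, rfl⟩ := hz
    have := m.2
    simp only [Finset.mem_Ico]; omega
  have k3 := card_translates_le (N := N) (2 ^ j) ((2 : ℝ) ^ j * x)
  gcongr

/-- The atoms of level `j` live on intervals of length of the order of `2 ^ (-j)`. -/
lemma dist_le_of_intervalAtom_ne_zero {R : ℝ}
    (hl0 : ∀ r < N, ∀ x, R < x → left r x = 0) (hg0 : Function.support g ⊆ Icc (1 - (N : ℝ)) N)
    (hr0 : ∀ r < N, ∀ x, x < -R → right r x = 0) {j : ℕ} {m : Fin (2 ^ j)} {x y : ℝ}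
    (hx : x ∈ Icc (0 : ℝ) 1) (hy : y ∈ Icc (0 : ℝ) 1)
    (hxm : intervalAtom N left g right j m x ≠ 0) (hym : intervalAtom N left g right j m y ≠ 0) :
    |x - y| ≤ max R (2 * N) / 2 ^ j := by
  have hpos : (0 : ℝ) < 2 ^ j := by positivity
  have habs : |x - y| * 2 ^ j = |(x - y) * 2 ^ j| := by rw [abs_mul, abs_of_pos hpos]
  rw [le_div_iff₀ hpos, habs]
  unfold intervalAtom at hxm hym
  have hxm := right_ne_zero_of_mul hxm
  have hym := right_ne_zero_of_mul hym
  have hx0 := mul_nonneg hpos.le hx.1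
  have hy0 := mul_nonneg hpos.le hy.1
  have hx1 : 0 ≤ (2 : ℝ) ^ j * (1 - x) := mul_nonneg hpos.le (by linarith [hx.2])
  have hy1 : 0 ≤ (2 : ℝ) ^ j * (1 - y) := mul_nonneg hpos.le (by linarith [hy.2])
  split_ifs at hxm hym with c1 c2
  · have h1 := not_lt.mp fun h => hxm (hl0 _ c1 _ h)
    have h2 := not_lt.mp fun h => hym (hl0 _ c1 _ h)
    refine le_trans ?_ (le_max_left _ _)
    rw [abs_le]; constructor <;> linarith
  · have h1 := not_lt.mp fun h => hxm (hr0 _ (by omega) _ h)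
    have h2 := not_lt.mp fun h => hym (hr0 _ (by omega) _ h)
    refine le_trans ?_ (le_max_left _ _)
    rw [abs_le]; constructor <;> linarith
  · have h1 := hg0 hxm
    have h2 := hg0 hym
    refine le_trans ?_ (le_max_right _ _)
    rw [abs_le]; constructor <;> linarith [h1.1, h1.2, h2.1, h2.2]

end Atom

namespace CDVBasis

variable {S : ℕ} (W : CDVBasis S) {d : ℕ}

lemma continuous_scaling (j : ℕ) (m : Fin (2 ^ j)) : Continuous (W.scaling j m) :=
  continuous_intervalAtom W.continuous_φLeft W.continuous_φ W.continuous_φRight j m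

lemma continuous_wavelet (j : ℕ) (m : Fin (2 ^ j)) : Continuous (W.wavelet j m) :=
  continuous_intervalAtom W.continuous_ψLeft W.continuous_ψ W.continuous_ψRight j m

lemma integral_scaling_mul_scaling {j : ℕ} (hj : W.J₀ ≤ j) (m m' : Fin (2 ^ j)) :
    ∫ x in Icc (0 : ℝ) 1, W.scaling j m x * W.scaling j m' x = if m = m' then 1 else 0 :=
  W.orthonormal_φ j hj m m'

lemma integral_wavelet_mul_wavelet {j : ℕ} (hj : W.J₀ ≤ j) (m m' : Fin (2 ^ j)) :
    ∫ x in Icc (0 : ℝ) 1, W.wavelet j m x * W.wavelet j m' x = if m = m' then 1 else 0 :=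
  W.orthonormal_ψ j hj m m'

lemma integral_scaling_mul_wavelet {j : ℕ} (hj : W.J₀ ≤ j) (m m' : Fin (2 ^ j)) :
    ∫ x in Icc (0 : ℝ) 1, W.scaling j m x * W.wavelet j m' x = 0 :=
  W.orthogonal_φ_ψ j hj m m'

lemma exists_sum_abs_scaling_wavelet_le : ∃ A, 1 ≤ A ∧ ∀ j : ℕ, ∀ x ∈ Icc (0 : ℝ) 1,
    ∑ m, |W.scaling j m x| ≤ A * (2 : ℝ) ^ ((j : ℝ) / 2) ∧
    ∑ m, |W.wavelet j m x| ≤ A * (2 : ℝ) ^ ((j : ℝ) / 2) := by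
  obtain ⟨A, hA, h⟩ := exists_sum_abs_intervalAtom_le W.continuous_φLeft W.continuous_φ
    W.continuous_φRight W.support_φLeft W.support_φ W.support_φRight
  obtain ⟨B, hB, h'⟩ := exists_sum_abs_intervalAtom_le W.continuous_ψLeft W.continuous_ψ
    W.continuous_ψRight W.support_ψLeft W.support_ψ W.support_ψRight
  refine ⟨1 + A + B, by linarith, fun j x hx => ⟨(h j x hx).trans ?_, (h' j x hx).trans ?_⟩⟩ <;>
  exact mul_le_mul_of_nonneg_right (by linarith) (by positivity)

/-- The span of the scaling functions of level `j` and of the wavelets of level `j` is that of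
the scaling functions of level `j + 1`: both systems are orthonormal and have `2 ^ (j + 1)`
elements, so that the matrix expressing the former by the latter is orthogonal. -/
lemma sum_scaling_succ_mul {j : ℕ} (hj : W.J₀ ≤ j) {x y : ℝ} (hx : x ∈ Icc (0 : ℝ) 1)
    (hy : y ∈ Icc (0 : ℝ) 1) :
    ∑ m, W.scaling (j + 1) m x * W.scaling (j + 1) m y =
      ∑ m, W.scaling j m x * W.scaling j m y + ∑ m, W.wavelet j m x * W.wavelet j m y := by
  choose a ha using W.refine_φ j hj
  choose b hb using W.refine_ψ j hj
  -- `c` expresses the joint system `f` by the scaling functions of level `j + 1`.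
  let f : Fin (2 ^ j) ⊕ Fin (2 ^ j) → ℝ → ℝ := Sum.elim (W.scaling j) (W.wavelet j)
  let c : Matrix (Fin (2 ^ j) ⊕ Fin (2 ^ j)) (Fin (2 ^ (j + 1))) ℝ := Matrix.of (Sum.elim a b)
  have hf : ∀ r, ∀ x ∈ Icc (0 : ℝ) 1, f r x = ∑ i, c r i * W.scaling (j + 1) i x := by
    rintro (m | m) x hx
    · exact ha m x hx
    · exact hb m x hx
  have horth : ∀ r r', ∫ x in Icc (0 : ℝ) 1, f r x * f r' x = if r = r' then 1 else 0 := by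
    rintro (m | m) (m' | m')
    · simpa [f] using W.integral_scaling_mul_scaling hj m m'
    · simpa [f] using W.integral_scaling_mul_wavelet hj m m'
    · simpa [f, mul_comm] using W.integral_scaling_mul_wavelet hj m' m
    · simpa [f] using W.integral_wavelet_mul_wavelet hj m m'
  have hint : ∀ i i', IntegrableOn (fun x => W.scaling (j + 1) i x * W.scaling (j + 1) i' x)
      (Icc (0 : ℝ) 1) := fun i i' =>
    ((W.continuous_scaling _ i).mul (W.continuous_scaling _ i')).continuousOn.integrableOn_Icc
  have hcc : c * c.transpose = 1 := by
    ext r r'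
    rw [Matrix.one_apply, ← horth r r', Matrix.mul_apply]
    have : ∫ x in Icc (0 : ℝ) 1, f r x * f r' x = ∫ x in Icc (0 : ℝ) 1, ∑ i, ∑ i',
        c r i * c r' i' * (W.scaling (j + 1) i x * W.scaling (j + 1) i' x) := by
      refine setIntegral_congr_fun measurableSet_Icc fun x hx => ?_
      simp only [hf r x hx, hf r' x hx, Finset.sum_mul_sum]
      exact Finset.sum_congr rfl fun i _ => Finset.sum_congr rfl fun i' _ => by ring
    rw [this, integral_finsetSum _ fun i _ => integrable_finsetSum _ fun i' _ =>
      (hint i i').const_mul _]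
    refine Finset.sum_congr rfl fun i _ => ?_
    rw [integral_finsetSum _ fun i' _ => (hint i i').const_mul _]
    simp_rw [integral_const_mul, W.integral_scaling_mul_scaling (by omega : W.J₀ ≤ j + 1)]
    simp [Matrix.transpose_apply]
  have hcc' : c.transpose * c = 1 := by
    refine (Matrix.mul_eq_one_comm_of_equiv (Fintype.equivOfCardEq ?_)).mp hcc
    simp only [Fintype.card_sum, Fintype.card_fin]; ring
  have key : ∑ r, f r x * f r y = ∑ m, W.scaling (j + 1) m x * W.scaling (j + 1) m y := by
    have h1 : ∀ r, f r x * f r y = ∑ i, ∑ i', c r i * c r i' *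
        (W.scaling (j + 1) i x * W.scaling (j + 1) i' y) := by
      intro r
      rw [hf r x hx, hf r y hy, Finset.sum_mul_sum]
      exact Finset.sum_congr rfl fun i _ => Finset.sum_congr rfl fun i' _ => by ring
    simp_rw [h1]
    rw [Finset.sum_comm]
    refine Finset.sum_congr rfl fun i _ => ?_
    rw [Finset.sum_comm]
    have h2 : ∀ i', ∑ r, c r i * c r i' = if i = i' then 1 else 0 := by
      intro i'
      have := congrFun (congrFun hcc' i) i'
      rwa [Matrix.mul_apply, Matrix.one_apply] at this
    simp_rw [← Finset.sum_mul, h2]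
    simp
  rw [← key, Fintype.sum_sum_type]
  rfl

/-- Nestedness of the multiresolution spaces. -/
lemma exists_scaling_eq_sum {l j : ℕ} (hl : W.J₀ ≤ l) (hlj : l ≤ j) (m : Fin (2 ^ l)) :
    ∃ c : Fin (2 ^ j) → ℝ, ∀ x ∈ Icc (0 : ℝ) 1, W.scaling l m x = ∑ i, c i * W.scaling j i x := by
  induction j, hlj using Nat.le_induction with
  | base => exact ⟨fun i => if m = i then 1 else 0, fun x _ => by simp⟩
  | succ j hlj ih =>
    obtain ⟨c, hc⟩ := ih
    choose a ha using W.refine_φ j (hl.trans hlj)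
    refine ⟨fun i => ∑ r, c r * a r i, fun x hx => ?_⟩
    rw [hc x hx]
    have : ∀ r, W.scaling j r x = ∑ i, a r i * W.scaling (j + 1) i x := fun r => ha r x hx
    simp_rw [this, Finset.mul_sum, Finset.sum_mul]
    rw [Finset.sum_comm]
    exact Finset.sum_congr rfl fun i _ => Finset.sum_congr rfl fun r _ => by ring

lemma integral_wavelet_mul_eq_zero_of_eq_sum {j : ℕ} (hj : W.J₀ ≤ j) (m : Fin (2 ^ j))
    {f : ℝ → ℝ} {c : Fin (2 ^ j) → ℝ}
    (hf : ∀ x ∈ Icc (0 : ℝ) 1, f x = ∑ i, c i * W.scaling j i x) :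
    ∫ x in Icc (0 : ℝ) 1, W.wavelet j m x * f x = 0 := by
  have : ∫ x in Icc (0 : ℝ) 1, W.wavelet j m x * f x = ∫ x in Icc (0 : ℝ) 1, ∑ i,
      c i * (W.scaling j i x * W.wavelet j m x) := by
    refine setIntegral_congr_fun measurableSet_Icc fun x hx => ?_
    simp only [hf x hx, Finset.mul_sum]
    exact Finset.sum_congr rfl fun i _ => by ring
  have hint : ∀ i, IntegrableOn (fun x => W.scaling j i x * W.wavelet j m x) (Icc (0 : ℝ) 1) :=
    fun i => ((W.continuous_scaling _ i).mul (W.continuous_wavelet _ m)).continuousOn.integrableOn_Icc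
  rw [this, integral_finsetSum _ fun i _ => (hint i).const_mul _]
  simp_rw [integral_const_mul, W.integral_scaling_mul_wavelet hj]
  simp

lemma integral_wavelet_mul_scaling {l j : ℕ} (hl : W.J₀ ≤ l) (hlj : l ≤ j) (m : Fin (2 ^ j))
    (m' : Fin (2 ^ l)) : ∫ x in Icc (0 : ℝ) 1, W.wavelet j m x * W.scaling l m' x = 0 := by
  obtain ⟨c, hc⟩ := W.exists_scaling_eq_sum hl hlj m'
  exact W.integral_wavelet_mul_eq_zero_of_eq_sum (hl.trans hlj) m hc

lemma integral_wavelet_mul_wavelet_of_lt {l j : ℕ} (hl : W.J₀ ≤ l) (hlj : l < j)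
    (m : Fin (2 ^ j)) (m' : Fin (2 ^ l)) :
    ∫ x in Icc (0 : ℝ) 1, W.wavelet j m x * W.wavelet l m' x = 0 := by
  obtain ⟨a, ha⟩ := W.refine_ψ l hl m'
  choose c hc using fun i => W.exists_scaling_eq_sum (hl.trans l.le_succ) hlj i
  refine W.integral_wavelet_mul_eq_zero_of_eq_sum (hl.trans hlj.le) m
    (c := fun i => ∑ r, a r * c r i) fun x hx => ?_
  refine (ha x hx).trans ?_
  have : ∀ r, intervalAtom W.N W.φLeft W.φ W.φRight (l + 1) r x =
    ∑ i, c r i * W.scaling j i x := fun r => hc r x hx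
  simp_rw [this, Finset.mul_sum, Finset.sum_mul]
  rw [Finset.sum_comm]
  exact Finset.sum_congr rfl fun i _ => Finset.sum_congr rfl fun r _ => by ring

lemma integral_wavelet_mul_wavelet_of_ne {l j : ℕ} (hl : W.J₀ ≤ l) (hj : W.J₀ ≤ j) (hlj : l ≠ j)
    (m : Fin (2 ^ j)) (m' : Fin (2 ^ l)) :
    ∫ x in Icc (0 : ℝ) 1, W.wavelet j m x * W.wavelet l m' x = 0 := by
  rcases lt_or_gt_of_ne hlj with h | h
  · exact W.integral_wavelet_mul_wavelet_of_lt hl h m m'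
  · simp_rw [mul_comm (W.wavelet j m _)]
    exact W.integral_wavelet_mul_wavelet_of_lt hj h m' m

/-- Reproduction of the constants, with the coefficients made explicit. -/
lemma sum_integral_scaling_mul (hS : 0 < S) {j : ℕ} (hj : W.J₀ ≤ j) {x : ℝ}
    (hx : x ∈ Icc (0 : ℝ) 1) :
    ∑ m, (∫ t in Icc (0 : ℝ) 1, W.scaling j m t) * W.scaling j m x = 1 := by
  obtain ⟨c, hc'⟩ := W.polynomials j hj 0 hS
  have hc : ∀ x ∈ Icc (0 : ℝ) 1, (1 : ℝ) = ∑ i, c i * W.scaling j i x := fun x hx =>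
    (pow_zero x).symm.trans (hc' x hx)
  have hcm : ∀ m, ∫ t in Icc (0 : ℝ) 1, W.scaling j m t = c m := by
    intro m
    have : ∫ t in Icc (0 : ℝ) 1, W.scaling j m t = ∫ t in Icc (0 : ℝ) 1,
        ∑ i, c i * (W.scaling j i t * W.scaling j m t) := by
      refine setIntegral_congr_fun measurableSet_Icc fun t ht => ?_
      calc W.scaling j m t = 1 * W.scaling j m t := (one_mul _).symm
        _ = _ := by
          rw [hc t ht, Finset.sum_mul]; exact Finset.sum_congr rfl fun i _ => by ring
    have hint : ∀ i, IntegrableOn (fun t => W.scaling j i t * W.scaling j m t) (Icc (0 : ℝ) 1) :=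
      fun i =>
        ((W.continuous_scaling _ i).mul (W.continuous_scaling _ m)).continuousOn.integrableOn_Icc
    rw [this, integral_finsetSum _ fun i _ => (hint i).const_mul _]
    simp_rw [integral_const_mul, W.integral_scaling_mul_scaling hj]
    simp
  simp_rw [hcm]
  exact (hc x hx).symm

end CDVBasis

/-! ### Tensor products and the projection kernel -/

section Cube

variable {d : ℕ}

lemma cube_eq_pi (d : ℕ) : cube d = Set.pi univ fun _ => Icc (0 : ℝ) 1 := by
  rw [Set.pi_univ_Icc]; rfl

lemma mem_cube_iff {x : Fin d → ℝ} : x ∈ cube d ↔ ∀ i, x i ∈ Icc (0 : ℝ) 1 := by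
  simp only [cube_eq_pi, mem_pi, mem_univ, true_implies]

lemma isCompact_cube (d : ℕ) : IsCompact (cube d) := isCompact_Icc

lemma measurableSet_cube (d : ℕ) : MeasurableSet (cube d) := measurableSet_Icc

lemma restrict_cube_eq_pi (d : ℕ) : (volume.restrict (cube d) : Measure (Fin d → ℝ)) =
    Measure.pi fun _ => volume.restrict (Icc (0 : ℝ) 1) := by
  rw [cube_eq_pi, volume_pi, Measure.restrict_pi_pi]

instance : IsProbabilityMeasure (volume.restrict (cube d) : Measure (Fin d → ℝ)) := by
  have : IsProbabilityMeasure (volume.restrict (Icc (0 : ℝ) 1)) := ⟨by simp⟩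
  rw [restrict_cube_eq_pi]
  infer_instance

lemma integral_cube_prod (f : Fin d → ℝ → ℝ) :
    ∫ x in cube d, ∏ i, f i (x i) = ∏ i, ∫ t in Icc (0 : ℝ) 1, f i t := by
  rw [restrict_cube_eq_pi, integral_fintype_prod_eq_prod (𝕜 := ℝ) f]

lemma _root_.ContinuousOn.integrableOn_cube {f : (Fin d → ℝ) → ℝ} (hf : ContinuousOn f (cube d)) :
    IntegrableOn f (cube d) := hf.integrableOn_compact (isCompact_cube d)

end Cube

lemma resolution_eq (d j : ℕ) : resolution d j = ((2 : ℝ) ^ j) ^ d := by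
  rw [resolution, pow_mul]

lemma one_le_resolution (d j : ℕ) : 1 ≤ resolution d j := one_le_pow₀ one_le_two

lemma resolution_pos (d j : ℕ) : 0 < resolution d j := by unfold resolution; positivity

namespace CDVBasis

variable {S : ℕ} (W : CDVBasis S) {d : ℕ}

lemma Phi_eq_Psi (j : ℕ) (m : Fin d → Fin (2 ^ j)) : W.Phi j m = W.Psi (fun _ => false) j m := by
  ext x; simp [Phi, Psi]

@[fun_prop]
lemma continuous_Psi (ι : Fin d → Bool) (l : ℕ) (m : Fin d → Fin (2 ^ l)) :
    Continuous (W.Psi ι l m) := by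
  unfold Psi
  refine continuous_finsetProd _ fun i _ => ?_
  split_ifs
  · exact (W.continuous_wavelet _ _).comp (continuous_apply i)
  · exact (W.continuous_scaling _ _).comp (continuous_apply i)

@[fun_prop]
lemma continuous_Phi (j : ℕ) (m : Fin d → Fin (2 ^ j)) : Continuous (W.Phi j m) := by
  rw [Phi_eq_Psi]; exact W.continuous_Psi _ _ _

lemma continuous_kernel_uncurry (j : ℕ) :
    Continuous fun z : (Fin d → ℝ) × (Fin d → ℝ) => W.kernel j z.1 z.2 := by
  unfold kernel
  fun_prop

@[fun_prop]
lemma continuous_kernel {X : Type*} [TopologicalSpace X] {f g : X → Fin d → ℝ} (j : ℕ)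
    (hf : Continuous f) (hg : Continuous g) : 
    Continuous fun z : X => W.kernel j (f z) (g z) :=
  (W.continuous_kernel_uncurry j).comp (f := fun z => (f z, g z)) (hf.prodMk hg)

@[fun_prop]
lemma measurable_kernel {X : Type*} [MeasurableSpace X] {f g : X → Fin d → ℝ} (j : ℕ)
    (hf : Measurable f) (hg : Measurable g) : 
    Measurable fun z : X => W.kernel j (f z) (g z) :=
  (W.continuous_kernel_uncurry j).measurable.comp (f := fun z => (f z, g z)) (hf.prodMk hg)

lemma kernel_comm (j : ℕ) (x y : Fin d → ℝ) : W.kernel j x y = W.kernel j y x := by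
  simp only [kernel, mul_comm]

lemma integral_Psi_mul_Psi (ι κ : Fin d → Bool) (l j : ℕ) (m : Fin d → Fin (2 ^ l))
    (m' : Fin d → Fin (2 ^ j)) : ∫ x in cube d, W.Psi ι l m x * W.Psi κ j m' x =
      ∏ i, ∫ t in Icc (0 : ℝ) 1, (if ι i then W.wavelet l (m i) t else W.scaling l (m i) t) *
        (if κ i then W.wavelet j (m' i) t else W.scaling j (m' i) t) := by
  rw [← integral_cube_prod]
  simp only [Psi, Finset.prod_mul_distrib]

lemma integral_Phi_mul_Phi {j : ℕ} (hj : W.J₀ ≤ j) (m m' : Fin d → Fin (2 ^ j)) :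
    ∫ x in cube d, W.Phi j m x * W.Phi j m' x = if m = m' then 1 else 0 := by
  simp_rw [Phi_eq_Psi]
  rw [integral_Psi_mul_Psi]
  simp only [Bool.false_eq_true, if_false]
  simp_rw [W.integral_scaling_mul_scaling hj, Finset.prod_ite_zero, funext_iff]
  simp

lemma kernel_eq_prod (j : ℕ) (x y : Fin d → ℝ) :
    W.kernel j x y = ∏ i, ∑ m, W.scaling j m (x i) * W.scaling j m (y i) := by
  simp only [kernel, Phi, ← Finset.prod_mul_distrib, Finset.prod_univ_sum, Fintype.piFinset_univ]

/-- The tensor wavelets of level `j` span the orthogonal complement of `V_j` in `V_{j+1}`: the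
kernel identity obtained by expanding the product of the one-dimensional ones. -/
lemma kernel_succ {j : ℕ} (hj : W.J₀ ≤ j) {x y : Fin d → ℝ} (hx : x ∈ cube d) (hy : y ∈ cube d) :
    W.kernel (j + 1) x y = ∑ ι : Fin d → Bool, ∑ m, W.Psi ι j m x * W.Psi ι j m y := by
  rw [mem_cube_iff] at hx hy
  have h1 : ∀ i, ∑ m, W.scaling (j + 1) m (x i) * W.scaling (j + 1) m (y i) =
      ∑ b : Bool, ∑ m, (if b then W.wavelet j m (x i) else W.scaling j m (x i)) *
        (if b then W.wavelet j m (y i) else W.scaling j m (y i)) := by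
    intro i
    rw [W.sum_scaling_succ_mul hj (hx i) (hy i), Fintype.sum_bool, add_comm]
    simp
  rw [kernel_eq_prod]
  simp_rw [h1]
  rw [Finset.prod_univ_sum, Fintype.piFinset_univ]
  refine Finset.sum_congr rfl fun ι _ => ?_
  rw [Finset.prod_univ_sum, Fintype.piFinset_univ]
  exact Finset.sum_congr rfl fun m _ => by rw [Psi, Psi, Finset.prod_mul_distrib]

lemma exists_sum_abs_Psi_le (d : ℕ) : ∃ A, 1 ≤ A ∧ ∀ (ι : Fin d → Bool) (l : ℕ), ∀ x ∈ cube d,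
    ∑ m, |W.Psi ι l m x| ≤ A * (2 : ℝ) ^ ((l : ℝ) * (d / 2)) := by
  obtain ⟨A, hA, h⟩ := W.exists_sum_abs_scaling_wavelet_le
  refine ⟨A ^ d, one_le_pow₀ hA, fun ι l x hx => ?_⟩
  rw [mem_cube_iff] at hx
  have h1 : ∑ m, |W.Psi ι l m x| =
      ∏ i, ∑ m, |if ι i then W.wavelet l m (x i) else W.scaling l m (x i)| := by
    rw [Finset.prod_univ_sum, Fintype.piFinset_univ]
    exact Finset.sum_congr rfl fun m _ => by rw [Psi, Finset.abs_prod]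
  rw [h1]
  calc _ ≤ ∏ _i : Fin d, (A * (2 : ℝ) ^ ((l : ℝ) / 2)) := by
        refine Finset.prod_le_prod (fun i _ => Finset.sum_nonneg fun _ _ => abs_nonneg _)
          fun i _ => ?_
        split_ifs
        · exact (h l _ (hx i)).2
        · exact (h l _ (hx i)).1
    _ = _ := by
        rw [Finset.prod_const, Finset.card_univ, Fintype.card_fin, mul_pow, ← Real.rpow_natCast
          ((2 : ℝ) ^ ((l : ℝ) / 2)), ← Real.rpow_mul two_pos.le]
        congr 2; ring

lemma two_rpow_mul_half_mul_self (l d : ℕ) :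
    (2 : ℝ) ^ ((l : ℝ) * (d / 2)) * (2 : ℝ) ^ ((l : ℝ) * (d / 2)) = resolution d l := by
  rw [← Real.rpow_add two_pos, resolution, ← Real.rpow_natCast]
  congr 1; push_cast; ring

lemma exists_abs_kernel_le (d : ℕ) : ∃ B, 1 ≤ B ∧ ∀ j, ∀ x ∈ cube d, ∀ y ∈ cube d,
    |W.kernel j x y| ≤ B * resolution d j := by
  obtain ⟨A, hA, h⟩ := W.exists_sum_abs_Psi_le d
  refine ⟨A * A, by nlinarith, fun j x hx y hy => ?_⟩
  calc |W.kernel j x y| ≤ ∑ m, |W.Phi j m x| * |W.Phi j m y| := by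
        unfold kernel
        refine (Finset.abs_sum_le_sum_abs _ _).trans (le_of_eq ?_)
        simp [abs_mul]
    _ ≤ (∑ m, |W.Phi j m x|) * ∑ m, |W.Phi j m y| := by
        rw [Finset.sum_mul]
        refine Finset.sum_le_sum fun m _ => mul_le_mul_of_nonneg_left ?_ (abs_nonneg _)
        exact Finset.single_le_sum (f := fun m => |W.Phi j m y|) (fun _ _ => abs_nonneg _)
          (Finset.mem_univ m)
    _ ≤ (A * (2 : ℝ) ^ ((j : ℝ) * (d / 2))) * (A * (2 : ℝ) ^ ((j : ℝ) * (d / 2))) := by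
        simp_rw [Phi_eq_Psi]
        refine mul_le_mul (h _ j x hx) (h _ j y hy) (Finset.sum_nonneg fun _ _ => abs_nonneg _) ?_
        positivity
    _ = _ := by rw [← two_rpow_mul_half_mul_self]; ring

/-- The kernel is concentrated near the diagonal. -/
lemma exists_kernel_eq_zero_of_lt_dist (d : ℕ) : ∃ ρ, 0 ≤ ρ ∧ ∀ j, ∀ x ∈ cube d, ∀ y ∈ cube d,
    ρ / 2 ^ j < dist x y → W.kernel j x y = 0 := by
  refine ⟨max W.R (2 * W.N), le_max_of_le_right (by positivity), fun j x hx y hy hxy => ?_⟩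
  rw [mem_cube_iff] at hx hy
  by_contra hne
  refine hxy.not_ge ((dist_pi_le_iff ?_).mpr fun i => ?_)
  · exact div_nonneg (le_max_of_le_right (by positivity)) (by positivity)
  rw [kernel_eq_prod] at hne
  have hi := Finset.prod_ne_zero_iff.mp hne i (Finset.mem_univ i)
  obtain ⟨m, _, hm⟩ := Finset.exists_ne_zero_of_sum_ne_zero hi
  rw [Real.dist_eq]
  exact dist_le_of_intervalAtom_ne_zero W.support_φLeft W.support_φ W.support_φRight (hx i) (hy i)
    (left_ne_zero_of_mul hm) (right_ne_zero_of_mul hm)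

lemma exists_integral_abs_kernel_le (d : ℕ) : ∃ B, 1 ≤ B ∧ ∀ j, ∀ x ∈ cube d,
    ∫ y in cube d, |W.kernel j x y| ≤ B := by
  obtain ⟨B, hB, h⟩ := W.exists_abs_kernel_le d
  obtain ⟨ρ, hρ, h0⟩ := W.exists_kernel_eq_zero_of_lt_dist d
  refine ⟨B * (1 + 2 * ρ) ^ d, one_le_mul_of_one_le_of_one_le hB (one_le_pow₀ (by linarith)),
    fun j x hx => ?_⟩
  have hr : (0 : ℝ) ≤ ρ / 2 ^ j := by positivity
  have hvol : volume.real (Metric.closedBall x (ρ / 2 ^ j)) = (2 * (ρ / 2 ^ j)) ^ d := by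
    rw [measureReal_def, Real.volume_pi_closedBall _ hr, Fintype.card_fin,
      ENNReal.toReal_ofReal (by positivity)]
  calc ∫ y in cube d, |W.kernel j x y|
      ≤ ∫ y in cube d, (Metric.closedBall x (ρ / 2 ^ j)).indicator
          (fun _ => B * resolution d j) y := by
        refine setIntegral_mono_on ?_ ?_ (measurableSet_cube d) fun y hy => ?_
        · exact ContinuousOn.integrableOn_cube (by fun_prop)
        · exact (integrable_const _).indicator Metric.isClosed_closedBall.measurableSet
        · by_cases hxy : dist x y ≤ ρ / 2 ^ j
          · rw [indicator_of_mem (by simpa [dist_comm] using hxy)]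
            exact h j x hx y hy
          · rw [h0 j x hx y hy (not_le.mp hxy), abs_zero]
            exact indicator_nonneg (fun _ _ => mul_nonneg (by linarith) (resolution_pos d j).le) _
    _ ≤ (2 * (ρ / 2 ^ j)) ^ d * (B * resolution d j) := by
        rw [integral_indicator Metric.isClosed_closedBall.measurableSet,
          Measure.restrict_restrict Metric.isClosed_closedBall.measurableSet, setIntegral_const,
          smul_eq_mul, ← hvol]
        refine mul_le_mul_of_nonneg_right ?_ (mul_nonneg (by linarith) (resolution_pos d j).le)
        refine measureReal_mono inter_subset_left ?_
        exact (isCompact_closedBall _ _).measure_lt_top.ne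
    _ = B * (2 * ρ) ^ d := by
        rw [resolution_eq, mul_comm, mul_assoc, ← mul_pow]
        congr 2; field_simp
    _ ≤ B * (1 + 2 * ρ) ^ d := by
        refine mul_le_mul_of_nonneg_left (pow_le_pow_left₀ (by linarith) (by linarith) d)
          (by linarith)

lemma integral_kernel (hS : 0 < S) {j : ℕ} (hj : W.J₀ ≤ j) {x : Fin d → ℝ} (hx : x ∈ cube d) :
    ∫ y in cube d, W.kernel j x y = 1 := by
  rw [mem_cube_iff] at hx
  unfold kernel
  rw [integral_finsetSum _ fun m _ =>
    ContinuousOn.integrableOn_cube (f := fun y => W.Phi j m x * W.Phi j m y) (by fun_prop)]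
  simp_rw [integral_const_mul]
  have : ∀ m : Fin d → Fin (2 ^ j), W.Phi j m x * ∫ y in cube d, W.Phi j m y =
      ∏ i, ((∫ t in Icc (0 : ℝ) 1, W.scaling j (m i) t) * W.scaling j (m i) (x i)) := by
    intro m
    unfold Phi
    rw [integral_cube_prod fun i => W.scaling j (m i), ← Finset.prod_mul_distrib]
    exact Finset.prod_congr rfl fun i _ => mul_comm _ _
  simp_rw [this]
  have h := Finset.prod_univ_sum (fun _ : Fin d => (Finset.univ : Finset (Fin (2 ^ j))))
    (fun i m => (∫ t in Icc (0 : ℝ) 1, W.scaling j m t) * W.scaling j m (x i))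
  rw [Fintype.piFinset_univ] at h
  rw [← h]
  exact Finset.prod_eq_one fun i _ => W.sum_integral_scaling_mul hS hj (hx i)

lemma integral_kernel_self {j : ℕ} (hj : W.J₀ ≤ j) :
    ∫ x in cube d, W.kernel j x x = resolution d j := by
  unfold kernel
  rw [integral_finsetSum _ fun m _ =>
    ContinuousOn.integrableOn_cube (f := fun x => W.Phi j m x * W.Phi j m x) (by fun_prop)]
  simp_rw [W.integral_Phi_mul_Phi hj]
  simp [resolution_eq]

end CDVBasis

/-! ### Approximation by wavelet projections -/

namespace CDVBasis

variable {S : ℕ} (W : CDVBasis S) {d : ℕ}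

/-- The coefficient `⟨h, Φ_{j m}⟩` in `L²([0,1]^d)`. -/
noncomputable def scalingCoeff (j : ℕ) (h : (Fin d → ℝ) → ℝ) (m : Fin d → Fin (2 ^ j)) : ℝ :=
  ∫ x in cube d, h x * W.Phi j m x

/-- The orthogonal projection of `h` onto the span of the `Φ_{j m}`, as a function defined
everywhere. -/
noncomputable def proj (j : ℕ) (h : (Fin d → ℝ) → ℝ) (x : Fin d → ℝ) : ℝ :=
  ∑ m, W.scalingCoeff j h m * W.Phi j m x

@[fun_prop]
lemma continuous_proj (j : ℕ) (h : (Fin d → ℝ) → ℝ) : Continuous (W.proj j h) := by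
  unfold proj; fun_prop

lemma proj_eq_integral_kernel {h : (Fin d → ℝ) → ℝ} (hh : ContinuousOn h (cube d)) (j : ℕ)
    (x : Fin d → ℝ) : W.proj j h x = ∫ y in cube d, W.kernel j x y * h y := by
  simp only [proj, scalingCoeff, kernel, ← integral_mul_const, Finset.sum_mul]
  rw [← integral_finsetSum _ fun m _ => ContinuousOn.integrableOn_cube
    (f := fun y => h y * W.Phi j m y * W.Phi j m x) (by fun_prop)]
  exact integral_congr_ae (ae_of_all _ fun y => Finset.sum_congr rfl fun m _ => by ring)

lemma integral_mul_proj {h f : (Fin d → ℝ) → ℝ} (hf : ContinuousOn f (cube d)) (j : ℕ) :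
    ∫ x in cube d, f x * W.proj j h x = ∑ m, W.scalingCoeff j f m * W.scalingCoeff j h m := by
  simp only [proj, Finset.mul_sum]
  rw [integral_finsetSum _ fun m _ => ContinuousOn.integrableOn_cube
    (f := fun x => f x * (W.scalingCoeff j h m * W.Phi j m x)) (by fun_prop)]
  refine Finset.sum_congr rfl fun m _ => ?_
  rw [show W.scalingCoeff j f m = ∫ x in cube d, f x * W.Phi j m x from rfl, ← integral_mul_const]
  exact integral_congr_ae (ae_of_all _ fun y => by ring)

lemma scalingCoeff_proj {j : ℕ} (hj : W.J₀ ≤ j) (h : (Fin d → ℝ) → ℝ) (m : Fin d → Fin (2 ^ j)) :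
    W.scalingCoeff j (W.proj j h) m = W.scalingCoeff j h m := by
  rw [scalingCoeff]
  simp only [proj, Finset.sum_mul]
  rw [integral_finsetSum _ fun i _ => ContinuousOn.integrableOn_cube
    (f := fun x => W.scalingCoeff j h i * W.Phi j i x * W.Phi j m x) (by fun_prop)]
  simp_rw [mul_assoc, integral_const_mul, W.integral_Phi_mul_Phi hj]
  simp

/-- The bias of the projection estimator of `∫ p b` is the inner product of the two residuals. -/
lemma integral_residual_mul_residual {p b : (Fin d → ℝ) → ℝ} (hp : ContinuousOn p (cube d))
    (hb : ContinuousOn b (cube d)) {j : ℕ} (hj : W.J₀ ≤ j) :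
    ∫ x in cube d, (p x - W.proj j p x) * (b x - W.proj j b x) =
      (∫ x in cube d, p x * b x) - ∑ m, W.scalingCoeff j p m * W.scalingCoeff j b m := by
  have e : ∀ x, (p x - W.proj j p x) * (b x - W.proj j b x) =
      p x * b x - p x * W.proj j b x - b x * W.proj j p x + W.proj j p x * W.proj j b x :=
    fun x => by ring
  simp_rw [e]
  have i1 : IntegrableOn (fun x => p x * b x) (cube d) :=
    ContinuousOn.integrableOn_cube (by fun_prop)
  have i2 : IntegrableOn (fun x => p x * W.proj j b x) (cube d) :=
    ContinuousOn.integrableOn_cube (by fun_prop)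
  have i3 : IntegrableOn (fun x => b x * W.proj j p x) (cube d) :=
    ContinuousOn.integrableOn_cube (by fun_prop)
  have i4 : IntegrableOn (fun x => W.proj j p x * W.proj j b x) (cube d) :=
    ContinuousOn.integrableOn_cube (by fun_prop)
  rw [integral_add (f := fun x => p x * b x - p x * W.proj j b x - b x * W.proj j p x)
      ((i1.sub i2).sub i3) i4,
    integral_sub (f := fun x => p x * b x - p x * W.proj j b x) (i1.sub i2) i3, integral_sub i1 i2,
    W.integral_mul_proj hp, W.integral_mul_proj hb,
    W.integral_mul_proj (W.continuous_proj j p).continuousOn]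
  simp_rw [W.scalingCoeff_proj hj]
  simp_rw [mul_comm (W.scalingCoeff j b _)]
  ring

variable {α M : ℝ} {h : (Fin d → ℝ) → ℝ}

lemma abs_integral_mul_Psi_le (hM : 0 ≤ M) (hh : h ∈ W.holderBall d α M) {l : ℕ} (hl : W.J₀ ≤ l)
    (m : Fin d → Fin (2 ^ l)) {ι : Fin d → Bool} (hι : ι ≠ fun _ => false) :
    |∫ x in cube d, h x * W.Psi ι l m x| ≤ M * (2 : ℝ) ^ (-((l : ℝ) * (α + d / 2))) := by
  have h1 : ENNReal.ofReal ((2 : ℝ) ^ ((l : ℝ) * (α + d / 2)) *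
      |∫ x in cube d, h x * W.Psi ι l m x|) ≤ ENNReal.ofReal M := by
    refine le_trans ?_ hh.2
    refine le_trans ?_ le_add_self
    exact le_iSup_of_le l (le_iSup_of_le hl (le_iSup_of_le m (le_iSup_of_le ι
      (le_iSup_of_le hι le_rfl))))
  rw [ENNReal.ofReal_le_ofReal_iff hM] at h1
  rw [Real.rpow_neg two_pos.le, ← div_eq_mul_inv, le_div_iff₀ (by positivity), mul_comm]
  exact h1

lemma proj_succ_sub_proj (hh : ContinuousOn h (cube d)) {j : ℕ} (hj : W.J₀ ≤ j) {x : Fin d → ℝ}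
    (hx : x ∈ cube d) : W.proj (j + 1) h x - W.proj j h x =
      ∑ ι ∈ Finset.univ.erase (fun _ => false), ∑ m,
        (∫ y in cube d, h y * W.Psi ι j m y) * W.Psi ι j m x := by
  have hsucc : W.proj (j + 1) h x =
      ∑ ι : Fin d → Bool, ∑ m, (∫ y in cube d, h y * W.Psi ι j m y) * W.Psi ι j m x := by
    rw [W.proj_eq_integral_kernel hh, setIntegral_congr_fun (measurableSet_cube d)
      (g := fun y => ∑ ι : Fin d → Bool, ∑ m, h y * W.Psi ι j m y * W.Psi ι j m x)]
    · have hint : ∀ (ι : Fin d → Bool) m, IntegrableOn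
          (fun y => h y * W.Psi ι j m y * W.Psi ι j m x) (cube d) := fun ι m =>
        ContinuousOn.integrableOn_cube (by fun_prop)
      rw [integral_finsetSum _ fun ι _ => integrable_finsetSum _ fun m _ => hint ι m]
      refine Finset.sum_congr rfl fun ι _ => ?_
      rw [integral_finsetSum _ fun m _ => hint ι m]
      simp_rw [integral_mul_const]
    · intro y hy
      simp only [W.kernel_succ hj hx hy, Finset.sum_mul]
      exact Finset.sum_congr rfl fun ι _ => Finset.sum_congr rfl fun m _ => by ring
  rw [hsucc, ← Finset.add_sum_erase _ _ (Finset.mem_univ fun _ => false)]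
  simp only [proj, scalingCoeff, Phi_eq_Psi]
  ring

/-- The increments of the projections of a function of smoothness `α` decay uniformly. -/
lemma exists_abs_proj_succ_sub_le (d : ℕ) : ∃ D, 0 ≤ D ∧ ∀ (α M : ℝ) (h : (Fin d → ℝ) → ℝ), 0 ≤ M →
    h ∈ W.holderBall d α M → ∀ j, W.J₀ ≤ j → ∀ x ∈ cube d,
      |W.proj (j + 1) h x - W.proj j h x| ≤ D * M * ((2 : ℝ) ^ (-α)) ^ j := by
  obtain ⟨A, hA, hΨ⟩ := W.exists_sum_abs_Psi_le d
  refine ⟨Fintype.card (Fin d → Bool) * A, by positivity, fun α M h hM hh j hj x hx => ?_⟩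
  have hterm : ∀ ι ∈ Finset.univ.erase (fun _ : Fin d => false),
      |∑ m, (∫ y in cube d, h y * W.Psi ι j m y) * W.Psi ι j m x| ≤
        A * M * ((2 : ℝ) ^ (-α)) ^ j := by
    intro ι hι
    calc _ ≤ ∑ m, |(∫ y in cube d, h y * W.Psi ι j m y)| * |W.Psi ι j m x| := by
          refine (Finset.abs_sum_le_sum_abs _ _).trans (le_of_eq ?_)
          simp_rw [abs_mul]
      _ ≤ ∑ m, M * (2 : ℝ) ^ (-((j : ℝ) * (α + d / 2))) * |W.Psi ι j m x| := by
          refine Finset.sum_le_sum fun m _ => mul_le_mul_of_nonneg_right ?_ (abs_nonneg _)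
          exact W.abs_integral_mul_Psi_le hM hh hj m (Finset.ne_of_mem_erase hι)
      _ ≤ M * (2 : ℝ) ^ (-((j : ℝ) * (α + d / 2))) * (A * (2 : ℝ) ^ ((j : ℝ) * (d / 2))) := by
          rw [← Finset.mul_sum]
          exact mul_le_mul_of_nonneg_left (hΨ ι j x hx) (by positivity)
      _ = A * M * ((2 : ℝ) ^ (-((j : ℝ) * (α + d / 2))) * (2 : ℝ) ^ ((j : ℝ) * (d / 2))) := by ring
      _ = _ := by
          rw [← Real.rpow_add two_pos, ← Real.rpow_natCast, ← Real.rpow_mul two_pos.le]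
          congr 2; ring
  rw [W.proj_succ_sub_proj hh.1 hj hx]
  calc _ ≤ ∑ ι ∈ Finset.univ.erase (fun _ : Fin d => false), A * M * ((2 : ℝ) ^ (-α)) ^ j :=
        (Finset.abs_sum_le_sum_abs _ _).trans (Finset.sum_le_sum hterm)
    _ ≤ ∑ _ι : Fin d → Bool, A * M * ((2 : ℝ) ^ (-α)) ^ j :=
        Finset.sum_le_sum_of_subset_of_nonneg (Finset.erase_subset _ _) fun _ _ _ => by positivity
    _ = _ := by rw [Finset.sum_const, nsmul_eq_mul, Finset.card_univ]; ring

/-- The projections of a continuous function converge pointwise: the kernels integrate to one,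
are bounded in `L¹` and concentrate at the diagonal. -/
lemma tendsto_proj (hS : 0 < S) (hh : ContinuousOn h (cube d)) {x : Fin d → ℝ} (hx : x ∈ cube d) :
    Filter.Tendsto (fun j => W.proj j h x) Filter.atTop (nhds (h x)) := by
  obtain ⟨B, hB, hK⟩ := W.exists_integral_abs_kernel_le d
  obtain ⟨ρ, hρ, h0⟩ := W.exists_kernel_eq_zero_of_lt_dist d
  rw [Metric.tendsto_atTop]
  intro ε hε
  obtain ⟨δ, hδ, hδh⟩ := Metric.continuousOn_iff.mp hh x hx (ε / (2 * B)) (by positivity)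
  have hlim : Filter.Tendsto (fun j : ℕ => ρ / (2 : ℝ) ^ j) Filter.atTop (nhds 0) :=
    tendsto_const_nhds.div_atTop (tendsto_pow_atTop_atTop_of_one_lt one_lt_two)
  obtain ⟨j₀, hj₀⟩ := Filter.eventually_atTop.mp (hlim.eventually (gt_mem_nhds hδ))
  refine ⟨max j₀ W.J₀, fun j hj => ?_⟩
  have hjJ : W.J₀ ≤ j := (le_max_right _ _).trans hj
  have hc1 : IntegrableOn (fun y => W.kernel j x y * h y) (cube d) :=
    ContinuousOn.integrableOn_cube
      ((W.continuous_kernel j continuous_const continuous_id).continuousOn.mul hh)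
  have hc2 : IntegrableOn (fun y => W.kernel j x y * h x) (cube d) :=
    ContinuousOn.integrableOn_cube (by fun_prop)
  have e : W.proj j h x - h x = ∫ y in cube d, W.kernel j x y * (h y - h x) := by
    simp_rw [mul_sub]
    rw [integral_sub hc1 hc2, integral_mul_const, W.integral_kernel hS hjJ hx, one_mul,
      W.proj_eq_integral_kernel hh]
  rw [Real.dist_eq, e]
  calc |∫ y in cube d, W.kernel j x y * (h y - h x)|
      ≤ ∫ y in cube d, |W.kernel j x y * (h y - h x)| := abs_integral_le_integral_abs
    _ ≤ ∫ y in cube d, |W.kernel j x y| * (ε / (2 * B)) := by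
        refine setIntegral_mono_on ?_ ?_ (measurableSet_cube d) fun y hy => ?_
        · refine Integrable.abs ?_
          simp_rw [mul_sub]
          exact hc1.sub hc2
        · exact ContinuousOn.integrableOn_cube (by fun_prop)
        · rw [abs_mul]
          by_cases hxy : ρ / 2 ^ j < dist x y
          · simp [h0 j x hx y hy hxy]
          · refine mul_le_mul_of_nonneg_left ?_ (abs_nonneg _)
            have := hδh y hy (by
              rw [dist_comm]
              exact (not_lt.mp hxy).trans_lt (hj₀ j ((le_max_left _ _).trans hj)))
            rw [Real.dist_eq] at this
            exact this.le
    _ ≤ B * (ε / (2 * B)) := by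
        rw [integral_mul_const]
        exact mul_le_mul_of_nonneg_right (hK j x hx) (by positivity)
    _ < ε := by
        have : B * (ε / (2 * B)) = ε / 2 := by field_simp
        linarith

/-- The approximation rate over Hölder balls in the uniform norm. -/
lemma exists_abs_sub_proj_le (d : ℕ) (hS : 0 < S) {α M : ℝ} (hα : 0 < α) (hM : 0 ≤ M) :
    ∃ D, 0 ≤ D ∧ ∀ h ∈ W.holderBall d α M, ∀ j, W.J₀ ≤ j → ∀ x ∈ cube d,
      |h x - W.proj j h x| ≤ D * ((2 : ℝ) ^ (-α)) ^ j := by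
  obtain ⟨D, hD, hproj⟩ := W.exists_abs_proj_succ_sub_le d
  have hr : (2 : ℝ) ^ (-α) < 1 := Real.rpow_lt_one_of_one_lt_of_neg one_lt_two (by linarith)
  refine ⟨D * M / (1 - (2 : ℝ) ^ (-α)), div_nonneg (by positivity) (by linarith),
    fun h hh j hj x hx => ?_⟩
  have hlim : Filter.Tendsto (fun i => W.proj (j + i) h x) Filter.atTop (nhds (h x)) := by
    have := (Filter.tendsto_add_atTop_iff_nat j).mpr (W.tendsto_proj hS hh.1 hx)
    simpa only [add_comm] using this
  have := dist_le_of_le_geometric_of_tendsto₀ ((2 : ℝ) ^ (-α)) (D * M * ((2 : ℝ) ^ (-α)) ^ j) hr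
    (fun i => by
      rw [dist_comm, Real.dist_eq]
      refine (hproj α M h hM hh (j + i) (by omega) x hx).trans (le_of_eq ?_)
      rw [pow_add]; ring) hlim
  rw [add_zero, dist_comm, Real.dist_eq] at this
  refine this.trans (le_of_eq ?_)
  ring

/-- The approximation bias of the functional. -/
lemma exists_abs_integral_mul_sub_le (d : ℕ) (hS : 0 < S) {α β M : ℝ} (hα : 0 < α) (hβ : 0 < β)
    (hM : 0 ≤ M) : ∃ D, 0 ≤ D ∧ ∀ p ∈ W.holderBall d α M, ∀ b ∈ W.holderBall d β M, ∀ j,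
      W.J₀ ≤ j → |(∫ x in cube d, p x * b x) - ∑ m, W.scalingCoeff j p m * W.scalingCoeff j b m| ≤
        D * ((2 : ℝ) ^ (-(α + β))) ^ j := by
  obtain ⟨D₁, hD₁, h₁⟩ := W.exists_abs_sub_proj_le d hS hα hM
  obtain ⟨D₂, hD₂, h₂⟩ := W.exists_abs_sub_proj_le d hS hβ hM
  refine ⟨D₁ * D₂, mul_nonneg hD₁ hD₂, fun p hp b hb j hj => ?_⟩
  rw [← W.integral_residual_mul_residual hp.1 hb.1 hj]
  have := norm_setIntegral_le_of_norm_le_const (μ := volume) (s := cube d)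
    (f := fun x => (p x - W.proj j p x) * (b x - W.proj j b x))
    (C := D₁ * D₂ * ((2 : ℝ) ^ (-(α + β))) ^ j) (isCompact_cube d).measure_lt_top fun x hx => by
      rw [Real.norm_eq_abs, abs_mul]
      calc _ ≤ (D₁ * ((2 : ℝ) ^ (-α)) ^ j) * (D₂ * ((2 : ℝ) ^ (-β)) ^ j) :=
            mul_le_mul (h₁ p hp j hj x hx) (h₂ b hb j hj x hx) (abs_nonneg _) (by positivity)
        _ = _ := by
            rw [neg_add, Real.rpow_add two_pos, mul_pow]; ring
  have hv : volume.real (cube d) = 1 := by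
    have := measure_univ (μ := (volume.restrict (cube d) : Measure (Fin d → ℝ)))
    rw [Measure.restrict_apply_univ] at this
    rw [measureReal_def, this, ENNReal.toReal_one]
  rwa [hv, mul_one, Real.norm_eq_abs] at this

/-- The kernels act as bounded bilinear forms on bounded functions. -/
lemma exists_abs_sum_scalingCoeff_mul_le (d : ℕ) : ∃ B, 1 ≤ B ∧ ∀ (D : ℝ) (p b : (Fin d → ℝ) → ℝ),
    ContinuousOn p (cube d) → ContinuousOn b (cube d) →
    (∀ᵐ x ∂volume.restrict (cube d), |p x| ≤ D) → (∀ᵐ x ∂volume.restrict (cube d), |b x| ≤ D) →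
    ∀ j, |∑ m, W.scalingCoeff j p m * W.scalingCoeff j b m| ≤ B * D ^ 2 := by
  obtain ⟨B, hB, hK⟩ := W.exists_integral_abs_kernel_le d
  refine ⟨B, hB, fun D p b hp hb hpD hbD j => ?_⟩
  have hD : 0 ≤ D := by
    obtain ⟨x, hx⟩ := hpD.exists
    exact (abs_nonneg _).trans hx
  have hproj : ∀ x ∈ cube d, |W.proj j b x| ≤ B * D := by
    intro x hx
    rw [W.proj_eq_integral_kernel hb]
    calc _ ≤ ∫ y in cube d, |W.kernel j x y * b y| := abs_integral_le_integral_abs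
      _ ≤ ∫ y in cube d, |W.kernel j x y| * D := by
          refine integral_mono_ae ?_ ?_ ?_
          · exact (ContinuousOn.integrableOn_cube
              ((W.continuous_kernel j continuous_const continuous_id).continuousOn.mul hb)).abs
          · exact ContinuousOn.integrableOn_cube (by fun_prop)
          · filter_upwards [hbD] with y hy
            rw [abs_mul]
            exact mul_le_mul_of_nonneg_left hy (abs_nonneg _)
      _ ≤ B * D := by
          rw [integral_mul_const]
          exact mul_le_mul_of_nonneg_right (hK j x hx) hD
  rw [← W.integral_mul_proj hp]
  have := norm_integral_le_of_norm_le_const (μ := volume.restrict (cube d))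
    (f := fun x => p x * W.proj j b x) (C := B * D ^ 2) (by
      filter_upwards [hpD, ae_restrict_mem (measurableSet_cube d)] with x hx hxc
      rw [Real.norm_eq_abs, abs_mul]
      calc _ ≤ D * (B * D) := mul_le_mul hx (hproj x hxc) (abs_nonneg _) hD
        _ = _ := by ring)
  simpa using this

end CDVBasis

/-! ### The bias of the estimator -/

section RegressionLaw

variable {S d : ℕ}

@[fun_prop] lemma measurable_obsX : Measurable (obsX : Obs d → Fin d → ℝ) := measurable_fst

@[fun_prop] lemma measurable_obsA : Measurable (obsA : Obs d → ℝ) :=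
  measurable_fst.comp measurable_snd

@[fun_prop] lemma measurable_obsY : Measurable (obsY : Obs d → ℝ) :=
  measurable_snd.comp measurable_snd

lemma sigmaX_le : sigmaX d ≤ (inferInstance : MeasurableSpace (Obs d)) :=
  measurable_obsX.comap_le

/-- `P` is a law of `(X, A, Y)` with `X` uniform on the cube and `A`, `Y` bounded by `D`, and `p`,
`b` are continuous versions of the regression functions of `A` and of `Y` on `X`. -/
structure RegressionLaw (P : Measure (Obs d)) (D : ℝ) (p b : (Fin d → ℝ) → ℝ) : Prop where
  isProbabilityMeasure : IsProbabilityMeasure P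
  uniform : P.map obsX = volume.restrict (cube d)
  abs_A_le : ∀ᵐ o ∂P, |obsA o| ≤ D
  abs_Y_le : ∀ᵐ o ∂P, |obsY o| ≤ D
  continuousOn_p : ContinuousOn p (cube d)
  continuousOn_b : ContinuousOn b (cube d)
  condExp_A : P[obsA | sigmaX d] =ᵐ[P] fun o => p (obsX o)
  condExp_Y : P[obsY | sigmaX d] =ᵐ[P] fun o => b (obsX o)

lemma IsModelLaw.exists_regressionLaw {W : CDVBasis S} {α β M C₁ C₂ : ℝ} {P : Measure (Obs d)}
    (hP : IsModelLaw W α β M C₁ C₂ P) : ∃ p ∈ W.holderBall d α M, ∃ b ∈ W.holderBall d β M,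
      RegressionLaw P (max |C₁| |C₂|) p b := by
  obtain ⟨p, hp, hpA⟩ := hP.holder_p
  obtain ⟨b, hb, hbY⟩ := hP.holder_b
  refine ⟨p, hp, b, hb, hP.isProbabilityMeasure, hP.uniform, ?_, ?_, hp.1, hb.1, hpA, hbY⟩
  · filter_upwards [hP.bounded_A] with o ho using abs_le_max_abs_abs ho.1 ho.2
  · filter_upwards [hP.bounded_Y] with o ho using abs_le_max_abs_abs ho.1 ho.2

/-- The set of observations with covariate in the cube and responses bounded by `D`. -/
def boundedObs (d : ℕ) (D : ℝ) : Set (Obs d) := {o | obsX o ∈ cube d ∧ |obsA o| ≤ D ∧ |obsY o| ≤ D}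

namespace RegressionLaw

variable {P : Measure (Obs d)} {D : ℝ} {p b : (Fin d → ℝ) → ℝ}

lemma ae_obsX_mem (h : RegressionLaw P D p b) : ∀ᵐ o ∂P, obsX o ∈ cube d := by
  have : ∀ᵐ x ∂P.map obsX, x ∈ cube d := by
    rw [h.uniform]; exact ae_restrict_mem (measurableSet_cube d)
  exact ae_of_ae_map measurable_obsX.aemeasurable this

lemma ae_mem_boundedObs (h : RegressionLaw P D p b) : ∀ᵐ o ∂P, o ∈ boundedObs d D := by
  filter_upwards [h.ae_obsX_mem, h.abs_A_le, h.abs_Y_le] with o h1 h2 h3 using ⟨h1, h2, h3⟩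

lemma nonneg (h : RegressionLaw P D p b) : 0 ≤ D := by
  have := h.isProbabilityMeasure
  obtain ⟨o, ho⟩ := h.abs_A_le.exists
  exact (abs_nonneg _).trans ho

lemma integral_comp_obsX (h : RegressionLaw P D p b) {g : (Fin d → ℝ) → ℝ}
    (hg : ContinuousOn g (cube d)) : ∫ o, g (obsX o) ∂P = ∫ x in cube d, g x := by
  rw [← h.uniform, integral_map measurable_obsX.aemeasurable]
  rw [h.uniform]
  exact hg.aestronglyMeasurable (measurableSet_cube d)

lemma integrable_A (h : RegressionLaw P D p b) : Integrable obsA P := by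
  have := h.isProbabilityMeasure
  exact Integrable.of_bound measurable_obsA.aestronglyMeasurable D h.abs_A_le

lemma integrable_Y (h : RegressionLaw P D p b) : Integrable obsY P := by
  have := h.isProbabilityMeasure
  exact Integrable.of_bound measurable_obsY.aestronglyMeasurable D h.abs_Y_le

lemma ae_mem_Icc_of_condExp (h : RegressionLaw P D p b) {V : Obs d → ℝ} {q : (Fin d → ℝ) → ℝ}
    {u v : ℝ} (hVi : Integrable V P) (hV : ∀ᵐ o ∂P, V o ∈ Icc u v) (hq : ContinuousOn q (cube d))
    (hVq : P[V | sigmaX d] =ᵐ[P] fun o => q (obsX o)) :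
    ∀ᵐ x ∂volume.restrict (cube d), q x ∈ Icc u v := by
  have := h.isProbabilityMeasure
  have hm : AEMeasurable q (P.map obsX) := by
    rw [h.uniform]; exact (hq.aestronglyMeasurable (measurableSet_cube d)).aemeasurable
  have hnull : NullMeasurableSet {x | q x ∈ Icc u v} (P.map obsX) :=
    hm.nullMeasurableSet_preimage measurableSet_Icc
  have h1 : P[fun _ => u | sigmaX d] ≤ᵐ[P] P[V | sigmaX d] :=
    condExp_mono (integrable_const _) hVi (hV.mono fun o ho => ho.1)
  have h2 : P[V | sigmaX d] ≤ᵐ[P] P[fun _ => v | sigmaX d] :=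
    condExp_mono hVi (integrable_const _) (hV.mono fun o ho => ho.2)
  rw [condExp_const sigmaX_le] at h1 h2
  rw [← h.uniform, ae_iff, ← compl_ofPred, Measure.map_apply₀ measurable_obsX.aemeasurable
    hnull.compl, preimage_compl]
  change ∀ᵐ o ∂P, q (obsX o) ∈ Icc u v
  filter_upwards [h1, h2, hVq] with o h1 h2 h3
  rw [h3] at h1 h2
  exact ⟨h1, h2⟩

lemma ae_abs_p_le (h : RegressionLaw P D p b) : ∀ᵐ x ∂volume.restrict (cube d), |p x| ≤ D := by
  simp_rw [abs_le]
  exact h.ae_mem_Icc_of_condExp h.integrable_A (h.abs_A_le.mono fun o ho => abs_le.mp ho)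
    h.continuousOn_p h.condExp_A

lemma ae_abs_b_le (h : RegressionLaw P D p b) : ∀ᵐ x ∂volume.restrict (cube d), |b x| ≤ D := by
  simp_rw [abs_le]
  exact h.ae_mem_Icc_of_condExp h.integrable_Y (h.abs_Y_le.mono fun o ho => abs_le.mp ho)
    h.continuousOn_b h.condExp_Y

/-- Conditioning on the covariate replaces a response by its regression function. -/
lemma integral_mul_eq (h : RegressionLaw P D p b) {V f : Obs d → ℝ} {q g : (Fin d → ℝ) → ℝ}
    (hVm : Measurable V) (hV : ∀ᵐ o ∂P, |V o| ≤ D) (hq : ContinuousOn q (cube d))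
    (hVq : P[V | sigmaX d] =ᵐ[P] fun o => q (obsX o)) (hf : AEStronglyMeasurable[sigmaX d] f P)
    {B : ℝ} (hfB : ∀ᵐ o ∂P, |f o| ≤ B) (hfg : f =ᵐ[P] fun o => g (obsX o))
    (hg : ContinuousOn g (cube d)) : ∫ o, V o * f o ∂P = ∫ x in cube d, q x * g x := by
  have := h.isProbabilityMeasure
  have hVi : Integrable V P := Integrable.of_bound hVm.aestronglyMeasurable D hV
  have hVf : Integrable (V * f) P :=
    hVi.mul_bdd (c := B) (hf.mono sigmaX_le) hfB
  calc ∫ o, V o * f o ∂P = ∫ o, (P[V * f | sigmaX d]) o ∂P := (integral_condExp sigmaX_le).symm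
    _ = ∫ o, q (obsX o) * g (obsX o) ∂P := by
        refine integral_congr_ae ?_
        filter_upwards [condExp_mul_of_aestronglyMeasurable_right hf hVf hVi, hVq, hfg]
          with o h1 h2 h3
        rw [h1, Pi.mul_apply, h2, h3]
    _ = _ := h.integral_comp_obsX (g := fun x => q x * g x) (hq.mul hg)

lemma integral_mul_comp_obsX (h : RegressionLaw P D p b) {V : Obs d → ℝ} {q g : (Fin d → ℝ) → ℝ}
    (hVm : Measurable V) (hV : ∀ᵐ o ∂P, |V o| ≤ D) (hq : ContinuousOn q (cube d))
    (hVq : P[V | sigmaX d] =ᵐ[P] fun o => q (obsX o)) (hg : Continuous g) :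
    ∫ o, V o * g (obsX o) ∂P = ∫ x in cube d, q x * g x := by
  obtain ⟨B, hB⟩ := (isCompact_cube d).exists_bound_of_continuousOn hg.continuousOn
  refine h.integral_mul_eq hVm hV hq hVq (f := fun o => g (obsX o)) (B := B) ?_ ?_
    (Filter.EventuallyEq.refl _ _) hg.continuousOn
  · exact (hg.measurable.comp (comap_measurable obsX)).stronglyMeasurable.aestronglyMeasurable
  · filter_upwards [h.ae_obsX_mem] with o ho using hB _ ho

lemma expCondCov_eq (h : RegressionLaw P D p b) :
    expCondCov P = (∫ o, obsA o * obsY o ∂P) - ∫ x in cube d, p x * b x := by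
  have := h.isProbabilityMeasure
  set cA := P[obsA | sigmaX d]
  set cY := P[obsY | sigmaX d]
  have hcA : AEStronglyMeasurable[sigmaX d] cA P := stronglyMeasurable_condExp.aestronglyMeasurable
  have hcY : AEStronglyMeasurable[sigmaX d] cY P := stronglyMeasurable_condExp.aestronglyMeasurable
  have bA : ∀ᵐ o ∂P, |cA o| ≤ D := ae_bdd_abs_condExp_of_ae_bdd_abs h.abs_A_le
  have bY : ∀ᵐ o ∂P, |cY o| ≤ D := ae_bdd_abs_condExp_of_ae_bdd_abs h.abs_Y_le
  have iAY : Integrable (fun o => obsA o * obsY o) P :=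
    h.integrable_A.mul_bdd (c := D) measurable_obsY.aestronglyMeasurable h.abs_Y_le
  have iAc : Integrable (fun o => obsA o * cY o) P :=
    h.integrable_A.mul_bdd (c := D) (hcY.mono sigmaX_le) bY
  have iYc : Integrable (fun o => obsY o * cA o) P :=
    h.integrable_Y.mul_bdd (c := D) (hcA.mono sigmaX_le) bA
  have icc : Integrable (fun o => cA o * cY o) P :=
    integrable_condExp.mul_bdd (c := D) (hcY.mono sigmaX_le) bY
  have e1 : ∫ o, obsA o * cY o ∂P = ∫ x in cube d, p x * b x :=
    h.integral_mul_eq measurable_obsA h.abs_A_le h.continuousOn_p h.condExp_A hcY bY h.condExp_Y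
      h.continuousOn_b
  have e2 : ∫ o, obsY o * cA o ∂P = ∫ x in cube d, p x * b x := by
    rw [h.integral_mul_eq measurable_obsY h.abs_Y_le h.continuousOn_b h.condExp_Y hcA bA
      h.condExp_A h.continuousOn_p]
    simp_rw [mul_comm]
  have e3 : ∫ o, cA o * cY o ∂P = ∫ x in cube d, p x * b x := by
    rw [← h.integral_comp_obsX (g := fun x => p x * b x)
      (h.continuousOn_p.mul h.continuousOn_b)]
    refine integral_congr_ae ?_
    filter_upwards [h.condExp_A, h.condExp_Y] with o h1 h2
    rw [← h1, ← h2]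
  rw [expCondCov, integral_condExp sigmaX_le]
  have e : ∀ o, (obsA o - cA o) * (obsY o - cY o) =
      obsA o * obsY o - obsA o * cY o - obsY o * cA o + cA o * cY o := fun o => by ring
  change ∫ o, (obsA o - cA o) * (obsY o - cY o) ∂P = _
  simp_rw [e]
  rw [integral_add (f := fun o => obsA o * obsY o - obsA o * cY o - obsY o * cA o)
      ((iAY.sub iAc).sub iYc) icc,
    integral_sub (f := fun o => obsA o * obsY o - obsA o * cY o) (iAY.sub iAc) iYc,
    integral_sub iAY iAc, e1, e2, e3]
  ring

end RegressionLaw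

end RegressionLaw

/-- The observations of an i.i.d. sample are independent. -/
lemma iIndepFun_eval {Ω : Type*} [MeasurableSpace Ω] (n : ℕ) (P : Measure Ω) [IsProbabilityMeasure P] :
    iIndepFun (fun (i : Fin n) (D : Fin n → Ω) => D i) (Measure.pi fun _ => P) :=
  iIndepFun_pi (μ := fun _ : Fin n => P) (X := fun _ => id) fun _ => aemeasurable_id

section Sample

variable {S d n : ℕ} (W : CDVBasis S)

/-- The estimator is the average over all pairs of observations, diagonal included, of this
function. -/
noncomputable def pairTerm (j : ℕ) (o o' : Obs d) : ℝ :=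
  obsA o * (obsY o - obsY o' * W.kernel j (obsX o') (obsX o))

@[fun_prop]
lemma measurable_pairTerm {T : Type*} [MeasurableSpace T] {f g : T → Obs d} (j : ℕ)
    (hf : Measurable f) (hg : Measurable g) : Measurable fun t => pairTerm W j (f t) (g t) := by
  unfold pairTerm
  fun_prop

lemma psiNR_eq_sum_pairTerm (hn : 1 ≤ n) (j : ℕ) (D : Fin n → Obs d) :
    psiNR W j D = (1 / (n : ℝ)) ^ 2 * ∑ i, ∑ l, pairTerm W j (D i) (D l) := by
  have hn0 : (n : ℝ) ≠ 0 := by positivity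
  rw [psiNR, pow_two, mul_assoc]
  refine congrArg _ ?_
  rw [Finset.mul_sum]
  refine Finset.sum_congr rfl fun i _ => ?_
  simp only [pairTerm, bHat, ← Finset.mul_sum, Finset.sum_sub_distrib, Finset.sum_const,
    Finset.card_univ, Fintype.card_fin, nsmul_eq_mul]
  field_simp

lemma abs_pairTerm_le {C : ℝ} {o o' : Obs d} (ho : o ∈ boundedObs d C)
    (ho' : o' ∈ boundedObs d C) (j : ℕ) :
    |pairTerm W j o o'| ≤ C ^ 2 * (1 + |W.kernel j (obsX o) (obsX o')|) := by
  have hC : 0 ≤ C := (abs_nonneg _).trans ho.2.1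
  rw [pairTerm, abs_mul, W.kernel_comm]
  calc _ ≤ C * (C + C * |W.kernel j (obsX o) (obsX o')|) := by
        refine mul_le_mul ho.2.1 ((abs_sub _ _).trans (add_le_add ho.2.2 ?_)) (abs_nonneg _) hC
        rw [abs_mul]
        exact mul_le_mul_of_nonneg_right ho'.2.2 (abs_nonneg _)
    _ = _ := by ring

variable {P : Measure (Obs d)} {C : ℝ} {p b : (Fin d → ℝ) → ℝ}

lemma RegressionLaw.ae_sample (h : RegressionLaw P C p b) (i : Fin n) :
    ∀ᵐ D ∂sampleLaw n P, D i ∈ boundedObs d C := by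
  have := h.isProbabilityMeasure
  exact (Measure.quasiMeasurePreserving_eval (μ := fun _ : Fin n => P) i).ae h.ae_mem_boundedObs

lemma RegressionLaw.memLp_pairTerm (h : RegressionLaw P C p b) (j : ℕ) (i l : Fin n) (q : ℝ≥0∞) :
    MemLp (fun D => pairTerm W j (D i) (D l)) q (sampleLaw n P) := by
  have := h.isProbabilityMeasure
  have : IsProbabilityMeasure (sampleLaw n P) := by unfold sampleLaw; infer_instance
  obtain ⟨B, hB, hK⟩ := W.exists_abs_kernel_le d
  refine MemLp.of_bound (Measurable.aestronglyMeasurable (by fun_prop))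
    (C ^ 2 * (1 + B * resolution d j)) ?_
  filter_upwards [h.ae_sample i, h.ae_sample l] with D hi hl
  refine (abs_pairTerm_le W hi hl j).trans ?_
  gcongr
  exact hK j _ hi.1 _ hl.1

lemma RegressionLaw.memLp_psiNR (h : RegressionLaw P C p b) (hn : 1 ≤ n) (j : ℕ) (q : ℝ≥0∞) :
    MemLp (fun D => psiNR W j D) q (sampleLaw n P) := by
  simp_rw [psiNR_eq_sum_pairTerm W hn]
  exact (memLp_finsetSum _ fun i _ => memLp_finsetSum _ fun l _ =>
    h.memLp_pairTerm W j i l q).const_mul _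

lemma RegressionLaw.integrable_A_mul_Y (h : RegressionLaw P C p b) :
    Integrable (fun o => obsA o * obsY o) P :=
  h.integrable_A.mul_bdd (c := C) measurable_obsY.aestronglyMeasurable h.abs_Y_le

lemma RegressionLaw.integrable_A_mul_Y_mul_kernel (h : RegressionLaw P C p b) (j : ℕ) :
    Integrable (fun o => obsA o * obsY o * W.kernel j (obsX o) (obsX o)) P := by
  obtain ⟨B, hB, hK⟩ := W.exists_abs_kernel_le d
  refine h.integrable_A_mul_Y.mul_bdd (c := B * resolution d j)
    (Measurable.aestronglyMeasurable (by fun_prop)) ?_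
  filter_upwards [h.ae_obsX_mem] with o ho using hK j _ ho _ ho

lemma RegressionLaw.integral_pairTerm_self (h : RegressionLaw P C p b) (j : ℕ) (i : Fin n) :
    ∫ D, pairTerm W j (D i) (D i) ∂sampleLaw n P = (∫ o, obsA o * obsY o ∂P) -
      ∫ o, obsA o * obsY o * W.kernel j (obsX o) (obsX o) ∂P := by
  have := h.isProbabilityMeasure
  rw [sampleLaw, integral_comp_eval (μ := fun _ : Fin n => P) (i := i)
    (f := fun o => pairTerm W j o o) (Measurable.aestronglyMeasurable (by fun_prop)),
    ← integral_sub h.integrable_A_mul_Y (h.integrable_A_mul_Y_mul_kernel W j)]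
  exact integral_congr_ae (ae_of_all _ fun o => by simp only [pairTerm]; ring)

lemma RegressionLaw.integral_pairTerm_of_ne (h : RegressionLaw P C p b) (j : ℕ) {i l : Fin n}
    (hil : i ≠ l) : ∫ D, pairTerm W j (D i) (D l) ∂sampleLaw n P = (∫ o, obsA o * obsY o ∂P) -
      ∑ m, W.scalingCoeff j p m * W.scalingCoeff j b m := by
  have := h.isProbabilityMeasure
  have : IsProbabilityMeasure (sampleLaw n P) := by unfold sampleLaw; infer_instance
  have hmap : ∀ i : Fin n, (sampleLaw n P).map (fun D => D i) = P := fun i =>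
    (measurePreserving_eval (fun _ : Fin n => P) i).map_eq
  have hint : ∀ (f : Obs d → ℝ) (i : Fin n), Integrable f P →
      Integrable (fun D => f (D i)) (sampleLaw n P) := fun f i hf => by
    rw [← hmap i] at hf
    exact hf.comp_measurable (measurable_pi_apply i)
  have hΦ : ∀ m : Fin d → Fin (2 ^ j), ∃ B, ∀ᵐ o ∂P, |W.Phi j m (obsX o)| ≤ B := fun m => by
    obtain ⟨B, hB⟩ := (isCompact_cube d).exists_bound_of_continuousOn
      (W.continuous_Phi j m).continuousOn
    exact ⟨B, by filter_upwards [h.ae_obsX_mem] with o ho using hB _ ho⟩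
  have hmΦ : ∀ m : Fin d → Fin (2 ^ j), Measurable fun o : Obs d => W.Phi j m (obsX o) :=
    fun m => (W.continuous_Phi j m).measurable.comp measurable_obsX
  have hiA : ∀ m, Integrable (fun o => obsA o * W.Phi j m (obsX o)) P := fun m => by
    obtain ⟨B, hB⟩ := hΦ m
    exact h.integrable_A.mul_bdd (c := B) (hmΦ m).aestronglyMeasurable hB
  have hiY : ∀ m, Integrable (fun o => obsY o * W.Phi j m (obsX o)) P := fun m => by
    obtain ⟨B, hB⟩ := hΦ m
    exact h.integrable_Y.mul_bdd (c := B) (hmΦ m).aestronglyMeasurable hB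
  have hind : IndepFun (fun D : Fin n → Obs d => D i) (fun D => D l) (sampleLaw n P) :=
    (iIndepFun_eval n P).indepFun hil
  have hprod : ∀ m, ∫ D, (obsA (D i) * W.Phi j m (obsX (D i))) *
      (obsY (D l) * W.Phi j m (obsX (D l))) ∂sampleLaw n P =
      W.scalingCoeff j p m * W.scalingCoeff j b m := by
    intro m
    rw [hind.integral_fun_comp_mul_comp (f := fun o => obsA o * W.Phi j m (obsX o))
      (g := fun o => obsY o * W.Phi j m (obsX o)) (measurable_pi_apply i).aemeasurable
      (measurable_pi_apply l).aemeasurable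
      (by rw [hmap]; exact (hiA m).1) (by rw [hmap]; exact (hiY m).1), sampleLaw,
      integral_comp_eval (μ := fun _ : Fin n => P) (i := i)
        (f := fun o => obsA o * W.Phi j m (obsX o)) (hiA m).1,
      integral_comp_eval (μ := fun _ : Fin n => P) (i := l)
        (f := fun o => obsY o * W.Phi j m (obsX o)) (hiY m).1,
      h.integral_mul_comp_obsX measurable_obsA h.abs_A_le h.continuousOn_p h.condExp_A
        (W.continuous_Phi j m),
      h.integral_mul_comp_obsX measurable_obsY h.abs_Y_le h.continuousOn_b h.condExp_Y
        (W.continuous_Phi j m)]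
    rfl
  have hiprod : ∀ m, Integrable (fun D : Fin n → Obs d => (obsA (D i) * W.Phi j m (obsX (D i))) *
      (obsY (D l) * W.Phi j m (obsX (D l)))) (sampleLaw n P) := fun m =>
    (hind.comp (φ := fun o => obsA o * W.Phi j m (obsX o))
      (ψ := fun o => obsY o * W.Phi j m (obsX o)) (measurable_obsA.mul (hmΦ m))
      (measurable_obsY.mul (hmΦ m))).integrable_mul (hint _ i (hiA m)) (hint _ l (hiY m))
  have e : ∀ D : Fin n → Obs d, pairTerm W j (D i) (D l) = obsA (D i) * obsY (D i) -
      ∑ m, (obsA (D i) * W.Phi j m (obsX (D i))) * (obsY (D l) * W.Phi j m (obsX (D l))) := by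
    intro D
    simp only [pairTerm, CDVBasis.kernel, mul_sub, Finset.mul_sum]
    congr 1
    exact Finset.sum_congr rfl fun m _ => by ring
  simp_rw [e]
  rw [integral_sub (hint _ i h.integrable_A_mul_Y) (integrable_finsetSum _ fun m _ => hiprod m),
    integral_finsetSum _ fun m _ => hiprod m]
  simp_rw [hprod]
  rw [sampleLaw, integral_comp_eval (μ := fun _ : Fin n => P) (i := i)
    (f := fun o => obsA o * obsY o) h.integrable_A_mul_Y.1]

/-- The bias is the approximation bias, corrected for the `n` diagonal pairs among all `n ^ 2`
ones, for which the kernel does not average out. -/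
lemma RegressionLaw.integral_psiNR_sub (h : RegressionLaw P C p b) (hn : 1 ≤ n) (j : ℕ) :
    ∫ D, (psiNR W j D - expCondCov P) ∂sampleLaw n P =
      ((∫ x in cube d, p x * b x) - ∑ m, W.scalingCoeff j p m * W.scalingCoeff j b m) -
      1 / n * ((∫ o, obsA o * obsY o * W.kernel j (obsX o) (obsX o) ∂P) -
        ∑ m, W.scalingCoeff j p m * W.scalingCoeff j b m) := by
  have := h.isProbabilityMeasure
  have : IsProbabilityMeasure (sampleLaw n P) := by unfold sampleLaw; infer_instance
  have hn0 : (n : ℝ) ≠ 0 := by positivity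
  have hi : ∀ i l, Integrable (fun D : Fin n → Obs d => pairTerm W j (D i) (D l)) (sampleLaw n P) :=
    fun i l => (h.memLp_pairTerm W j i l 1).integrable le_rfl
  rw [integral_sub ((h.memLp_psiNR W hn j 1).integrable le_rfl) (integrable_const _),
    integral_const, probReal_univ, one_smul, h.expCondCov_eq]
  simp_rw [psiNR_eq_sum_pairTerm W hn]
  rw [integral_const_mul, integral_finsetSum _ fun i _ => integrable_finsetSum _ fun l _ => hi i l]
  simp_rw [fun i => integral_finsetSum (μ := sampleLaw n P) Finset.univ fun l _ => hi i l]
  have hpair : ∀ i l, ∫ D, pairTerm W j (D i) (D l) ∂sampleLaw n P =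
      (∫ o, obsA o * obsY o ∂P) - ∑ m, W.scalingCoeff j p m * W.scalingCoeff j b m +
        if i = l then ∑ m, W.scalingCoeff j p m * W.scalingCoeff j b m -
          ∫ o, obsA o * obsY o * W.kernel j (obsX o) (obsX o) ∂P else 0 := by
    intro i l
    split_ifs with hil
    · subst hil; rw [h.integral_pairTerm_self]; ring
    · rw [h.integral_pairTerm_of_ne W j hil]; ring
  simp_rw [hpair, Finset.sum_add_distrib, Finset.sum_ite_eq, Finset.mem_univ, if_true,
    Finset.sum_const, Finset.card_univ, Fintype.card_fin, nsmul_eq_mul]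
  field_simp
  ring

end Sample

/-! ### The variance of averages over pairs of observations -/

section PairAverage

lemma integral_comp_prodMk_le_of_indepFun {Ω T U : Type*} [MeasurableSpace Ω] [MeasurableSpace T]
    [MeasurableSpace U] {μ : Measure Ω} [IsProbabilityMeasure μ] {X : Ω → T} {Y : Ω → U}
    (hXY : IndepFun X Y μ) (hX : Measurable X) (hY : Measurable Y) {h : T → U → ℝ} {φ : T → ℝ}
    (hh : Measurable (Function.uncurry h))
    (hhi : Integrable (fun ω => h (X ω) (Y ω)) μ) (hφi : Integrable (fun ω => φ (X ω)) μ)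
    (hle : ∀ᵐ ω ∂μ, ∫ u, h (X ω) u ∂μ.map Y ≤ φ (X ω)) :
    ∫ ω, h (X ω) (Y ω) ∂μ ≤ ∫ ω, φ (X ω) ∂μ := by
  have : IsProbabilityMeasure (μ.map Y) := Measure.isProbabilityMeasure_map hY.aemeasurable
  have : IsProbabilityMeasure (μ.map X) := Measure.isProbabilityMeasure_map hX.aemeasurable
  have hmap := (indepFun_iff_map_prod_eq_prod_map_map hX.aemeasurable hY.aemeasurable).mp hXY
  have hint : Integrable (Function.uncurry h) ((μ.map X).prod (μ.map Y)) := by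
    rw [← hmap, integrable_map_measure hh.aestronglyMeasurable (hX.prodMk hY).aemeasurable]
    exact hhi
  have e1 : ∫ ω, h (X ω) (Y ω) ∂μ = ∫ t, ∫ u, h t u ∂μ.map Y ∂μ.map X := by
    have := integral_map (hX.prodMk hY).aemeasurable (μ := μ) hh.aestronglyMeasurable
    rw [hmap, integral_prod (f := Function.uncurry h) hint] at this
    exact this.symm
  have hm : StronglyMeasurable fun t => ∫ u, h t u ∂μ.map Y := by
    exact hh.stronglyMeasurable.integral_prod_right
  rw [e1, integral_map hX.aemeasurable hm.aestronglyMeasurable]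
  refine integral_mono_ae ?_ hφi hle
  exact (integrable_map_measure hm.aestronglyMeasurable hX.aemeasurable).mp
    hint.integral_prod_left

/-- A bound for the mixed second moments of `g` at two pairs of observations that share the index
`a`, when `g` is at most `κ` and its averages are at most `B`: a factor `κ` is lost for every
coincidence among the indices. -/
def pairWeight {n : ℕ} (B κ : ℝ) (a b c : Fin n) : ℝ :=
  B ^ 2 + B * κ * ((if a = b then 1 else 0) + (if a = c then 1 else 0) + if b = c then 1 else 0) +
    κ ^ 2 * (if a = b ∧ a = c then 1 else 0)

lemma pairWeight_nonneg {n : ℕ} {B κ : ℝ} (hB : 0 ≤ B) (hκ : 0 ≤ κ) (a b c : Fin n) :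
    0 ≤ pairWeight B κ a b c := by
  unfold pairWeight
  split_ifs <;> positivity

lemma sum_pairWeight (n : ℕ) (B κ : ℝ) : ∑ a : Fin n, ∑ b : Fin n, ∑ c : Fin n,
    pairWeight B κ a b c = n ^ 3 * B ^ 2 + 3 * n ^ 2 * (B * κ) + n * κ ^ 2 := by
  have h : ∀ a b : Fin n, ∑ c, (if a = b ∧ a = c then (1 : ℝ) else 0) = if a = b then 1 else 0 := by
    intro a b
    by_cases hab : a = b <;> simp [hab]
  simp only [pairWeight, Finset.sum_add_distrib, ← Finset.mul_sum, Finset.sum_const,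
    Finset.card_univ, Fintype.card_fin, nsmul_eq_mul, Finset.sum_ite_eq, Finset.mem_univ, if_true, h]
  ring

/-- A kernel on pairs of observations that is bounded by `κ` and, when one argument is averaged
out, by `B`, both on a set of full measure. -/
structure BoundedPairKernel {Ω : Type*} [MeasurableSpace Ω] (P : Measure Ω) (G : Set Ω) (B κ : ℝ)
    (g : Ω → Ω → ℝ) : Prop where
  ae_mem : ∀ᵐ o ∂P, o ∈ G
  measurable : Measurable (Function.uncurry g)
  symm : ∀ o o', g o o' = g o' o
  nonneg : ∀ o o', 0 ≤ g o o'
  le_bound : ∀ o ∈ G, ∀ o' ∈ G, g o o' ≤ κ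
  integral_le : ∀ o ∈ G, ∫ o', g o o' ∂P ≤ B

variable {Ω : Type*} [MeasurableSpace Ω] {P : Measure Ω} {G : Set Ω} {B κ : ℝ} {g : Ω → Ω → ℝ}
  {n : ℕ}

namespace BoundedPairKernel

lemma measurable_sample (hg : BoundedPairKernel P G B κ g) (a b : Fin n) :
    Measurable fun D : Fin n → Ω => g (D a) (D b) :=
  hg.measurable.comp (g := Function.uncurry g) (f := fun D : Fin n → Ω => (D a, D b))
    ((measurable_pi_apply a).prodMk (measurable_pi_apply b))

lemma integral_sample_nonneg (hg : BoundedPairKernel P G B κ g) (a b : Fin n) :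
    0 ≤ ∫ D, g (D a) (D b) ∂(Measure.pi fun _ : Fin n => P) :=
  integral_nonneg fun _ => hg.nonneg _ _

variable [IsProbabilityMeasure P]

lemma ae_sample (hg : BoundedPairKernel P G B κ g) (i : Fin n) :
    ∀ᵐ D ∂Measure.pi fun _ : Fin n => P, D i ∈ G :=
  (Measure.quasiMeasurePreserving_eval (μ := fun _ : Fin n => P) i).ae hg.ae_mem

lemma bound_nonneg (hg : BoundedPairKernel P G B κ g) : 0 ≤ B ∧ 0 ≤ κ := by
  obtain ⟨o, ho⟩ := hg.ae_mem.exists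
  exact ⟨(integral_nonneg fun _ => hg.nonneg _ _).trans (hg.integral_le o ho),
    (hg.nonneg o o).trans (hg.le_bound o ho o ho)⟩

lemma ae_le (hg : BoundedPairKernel P G B κ g) (a b : Fin n) :
    ∀ᵐ D ∂Measure.pi fun _ : Fin n => P, g (D a) (D b) ≤ κ := by
  filter_upwards [hg.ae_sample a, hg.ae_sample b] with D ha hb using hg.le_bound _ ha _ hb

lemma integrable_sample (hg : BoundedPairKernel P G B κ g) (a b : Fin n) :
    Integrable (fun D : Fin n → Ω => g (D a) (D b)) (Measure.pi fun _ : Fin n => P) := by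
  refine Integrable.of_bound (hg.measurable_sample a b).aestronglyMeasurable κ ?_
  filter_upwards [hg.ae_le a b] with D h
  rwa [Real.norm_of_nonneg (hg.nonneg _ _)]

lemma integrable_sample_mul (hg : BoundedPairKernel P G B κ g) (a b c e : Fin n) :
    Integrable (fun D : Fin n → Ω => g (D a) (D b) * g (D c) (D e))
      (Measure.pi fun _ : Fin n => P) := by
  refine (hg.integrable_sample a b).mul_bdd (c := κ)
    (hg.measurable_sample c e).aestronglyMeasurable ?_
  filter_upwards [hg.ae_le c e] with D h
  rwa [Real.norm_of_nonneg (hg.nonneg _ _)]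

lemma integral_sample_le (hg : BoundedPairKernel P G B κ g) (a b : Fin n) :
    ∫ D, g (D a) (D b) ∂(Measure.pi fun _ : Fin n => P) ≤ κ := by
  calc _ ≤ ∫ _D : Fin n → Ω, κ ∂(Measure.pi fun _ : Fin n => P) :=
        integral_mono_ae (hg.integrable_sample a b) (integrable_const _) (hg.ae_le a b)
    _ = κ := by simp

lemma integral_sample_le_of_ne (hg : BoundedPairKernel P G B κ g) {a b : Fin n} (hab : a ≠ b) :
    ∫ D, g (D a) (D b) ∂(Measure.pi fun _ : Fin n => P) ≤ B := by
  calc _ ≤ ∫ _D : Fin n → Ω, B ∂(Measure.pi fun _ : Fin n => P) := by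
        refine integral_comp_prodMk_le_of_indepFun ((iIndepFun_eval n P).indepFun hab)
          (measurable_pi_apply a) (measurable_pi_apply b) (φ := fun _ => B) hg.measurable
          (hg.integrable_sample a b) (integrable_const _) ?_
        filter_upwards [hg.ae_sample a] with D ha
        rw [(measurePreserving_eval (fun _ : Fin n => P) b).map_eq]
        exact hg.integral_le _ ha
    _ = B := by simp

lemma integral_mul_integral_le (hg : BoundedPairKernel P G B κ g) (a b c : Fin n) :
    (∫ D, g (D a) (D b) ∂(Measure.pi fun _ : Fin n => P)) *
      ∫ D, g (D a) (D c) ∂(Measure.pi fun _ : Fin n => P) ≤ pairWeight B κ a b c := by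
  obtain ⟨hB, hκ⟩ := hg.bound_nonneg
  have hBκ := mul_nonneg hB hκ
  unfold pairWeight
  by_cases hab : a = b <;> by_cases hac : a = c
  · have := mul_le_mul (hg.integral_sample_le a b) (hg.integral_sample_le a c)
      (hg.integral_sample_nonneg a c) hκ
    rw [if_pos (⟨hab, hac⟩ : a = b ∧ a = c)]
    split_ifs <;> nlinarith [sq_nonneg B]
  · have := mul_le_mul (hg.integral_sample_le a b) (hg.integral_sample_le_of_ne hac)
      (hg.integral_sample_nonneg a c) hκ
    rw [if_pos hab, if_neg (fun h => hac h.2 : ¬(a = b ∧ a = c))]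
    split_ifs <;> nlinarith [sq_nonneg B]
  · have := mul_le_mul (hg.integral_sample_le_of_ne hab) (hg.integral_sample_le a c)
      (hg.integral_sample_nonneg a c) hB
    rw [if_pos hac, if_neg (fun h => hab h.1 : ¬(a = b ∧ a = c))]
    split_ifs <;> nlinarith [sq_nonneg B]
  · have := mul_le_mul (hg.integral_sample_le_of_ne hab) (hg.integral_sample_le_of_ne hac)
      (hg.integral_sample_nonneg a c) hB
    rw [if_neg (fun h => hab h.1 : ¬(a = b ∧ a = c))]
    split_ifs <;> nlinarith [sq_nonneg B]

lemma integral_mul_le_bound_mul (hg : BoundedPairKernel P G B κ g) (a b c e : Fin n) :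
    ∫ D, g (D a) (D b) * g (D c) (D e) ∂(Measure.pi fun _ : Fin n => P) ≤
      κ * ∫ D, g (D c) (D e) ∂(Measure.pi fun _ : Fin n => P) := by
  rw [← integral_const_mul]
  refine integral_mono_ae (hg.integrable_sample_mul a b c e)
    ((hg.integrable_sample c e).const_mul _) ?_
  filter_upwards [hg.ae_le a b] with D h using mul_le_mul_of_nonneg_right h (hg.nonneg _ _)

lemma integral_mul_le (hg : BoundedPairKernel P G B κ g) (a b c : Fin n) :
    ∫ D, g (D a) (D b) * g (D a) (D c) ∂(Measure.pi fun _ : Fin n => P) ≤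
      pairWeight B κ a b c := by
  obtain ⟨hB, hκ⟩ := hg.bound_nonneg
  have hBκ := mul_nonneg hB hκ
  unfold pairWeight
  by_cases hab : a = b
  · have h1 := hg.integral_mul_le_bound_mul a b a c
    by_cases hac : a = c
    · have h2 := mul_le_mul_of_nonneg_left (hg.integral_sample_le a c) hκ
      rw [if_pos (⟨hab, hac⟩ : a = b ∧ a = c)]
      split_ifs <;> nlinarith [sq_nonneg B]
    · have h2 := mul_le_mul_of_nonneg_left (hg.integral_sample_le_of_ne hac) hκ
      rw [if_pos hab, if_neg (fun h => hac h.2 : ¬(a = b ∧ a = c))]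
      split_ifs <;> nlinarith [sq_nonneg B]
  · rw [if_neg (fun h => hab h.1 : ¬(a = b ∧ a = c))]
    have h2 := mul_le_mul_of_nonneg_left (hg.integral_sample_le_of_ne hab) hκ
    by_cases hbc : b = c
    · have h1 := hg.integral_mul_le_bound_mul a c a b
      subst hbc
      rw [if_pos rfl]
      split_ifs; nlinarith [sq_nonneg B]
    · by_cases hac : a = c
      · have h1 := hg.integral_mul_le_bound_mul a c a b
        simp_rw [fun D : Fin n → Ω => mul_comm (g (D a) (D c)) (g (D a) (D b))] at h1
        rw [if_pos hac]
        split_ifs; nlinarith [sq_nonneg B]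
      · have h1 : ∫ D, g (D a) (D b) * g (D a) (D c) ∂(Measure.pi fun _ : Fin n => P) ≤
            ∫ D, g (D a) (D b) * B ∂(Measure.pi fun _ : Fin n => P) := by
          have hi := (iIndepFun_eval n P).indepFun_prodMk (fun i => measurable_pi_apply i) a b c
            hac hbc
          refine integral_comp_prodMk_le_of_indepFun hi
            ((measurable_pi_apply a).prodMk (measurable_pi_apply b)) (measurable_pi_apply c)
            (h := fun t u => g t.1 t.2 * g t.1 u) (φ := fun t => g t.1 t.2 * B) ?_
            (hg.integrable_sample_mul a b a c) ((hg.integrable_sample a b).mul_const _) ?_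
          · exact (hg.measurable.comp measurable_fst).mul
              (hg.measurable.comp (measurable_fst.fst.prodMk measurable_snd))
          · filter_upwards [hg.ae_sample a] with D ha
            rw [(measurePreserving_eval (fun _ : Fin n => P) c).map_eq, integral_const_mul]
            exact mul_le_mul_of_nonneg_left (hg.integral_le _ ha) (hg.nonneg _ _)
        rw [integral_mul_const] at h1
        have h2 := mul_le_mul_of_nonneg_right (hg.integral_sample_le_of_ne hab) hB
        rw [if_neg hab, if_neg hac, if_neg hbc]
        nlinarith

variable {F : Ω → Ω → ℝ}

lemma memLp_of_abs_le (hg : BoundedPairKernel P G B κ g) (hF : Measurable (Function.uncurry F))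
    (hFg : ∀ o ∈ G, ∀ o' ∈ G, |F o o'| ≤ g o o') (a b : Fin n) :
    MemLp (fun D : Fin n → Ω => F (D a) (D b)) 2 (Measure.pi fun _ : Fin n => P) := by
  refine MemLp.of_bound (Measurable.aestronglyMeasurable
    (hF.comp (g := Function.uncurry F) (f := fun D : Fin n → Ω => (D a, D b))
      ((measurable_pi_apply a).prodMk (measurable_pi_apply b)))) κ ?_
  filter_upwards [hg.ae_sample a, hg.ae_sample b] with D ha hb
  exact (hFg _ ha _ hb).trans (hg.le_bound _ ha _ hb)

lemma abs_covariance_le (hg : BoundedPairKernel P G B κ g) (hF : Measurable (Function.uncurry F))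
    (hFg : ∀ o ∈ G, ∀ o' ∈ G, |F o o'| ≤ g o o') (i l i' l' : Fin n) :
    |cov[fun D : Fin n → Ω => F (D i) (D l), fun D => F (D i') (D l');
      Measure.pi fun _ : Fin n => P]| ≤
      ∫ D, g (D i) (D l) * g (D i') (D l') ∂(Measure.pi fun _ : Fin n => P) +
      (∫ D, g (D i) (D l) ∂(Measure.pi fun _ : Fin n => P)) *
        ∫ D, g (D i') (D l') ∂(Measure.pi fun _ : Fin n => P) := by
  have h1 := hg.memLp_of_abs_le hF hFg i l
  have h2 := hg.memLp_of_abs_le hF hFg i' l'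
  have hmean : ∀ a b : Fin n, |∫ D, F (D a) (D b) ∂(Measure.pi fun _ : Fin n => P)| ≤
      ∫ D, g (D a) (D b) ∂(Measure.pi fun _ : Fin n => P) := fun a b => by
    rw [← Real.norm_eq_abs]
    refine norm_integral_le_of_norm_le (hg.integrable_sample a b) ?_
    filter_upwards [hg.ae_sample a, hg.ae_sample b] with D ha hb using hFg _ ha _ hb
  rw [covariance_eq_sub h1 h2]
  refine (abs_sub _ _).trans (add_le_add ?_ ?_)
  · rw [← Real.norm_eq_abs]
    refine norm_integral_le_of_norm_le (hg.integrable_sample_mul i l i' l') ?_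
    filter_upwards [hg.ae_sample i, hg.ae_sample l, hg.ae_sample i', hg.ae_sample l']
      with D h1 h2 h3 h4
    rw [Pi.mul_apply, norm_mul]
    exact mul_le_mul (hFg _ h1 _ h2) (hFg _ h3 _ h4) (abs_nonneg _) (hg.nonneg _ _)
  · rw [abs_mul]
    exact mul_le_mul (hmean _ _) (hmean _ _) (abs_nonneg _) (hg.integral_sample_nonneg _ _)

/-- Pairs of observations without a common index are independent; the others are controlled by
`pairWeight`, according to the position of the common index. -/
lemma covariance_le (hg : BoundedPairKernel P G B κ g) (hF : Measurable (Function.uncurry F))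
    (hFg : ∀ o ∈ G, ∀ o' ∈ G, |F o o'| ≤ g o o') (i l i' l' : Fin n) :
    cov[fun D : Fin n → Ω => F (D i) (D l), fun D => F (D i') (D l');
      Measure.pi fun _ : Fin n => P] ≤
      2 * ((if i = i' then pairWeight B κ i l l' else 0) +
        (if i = l' then pairWeight B κ i l i' else 0) +
        (if l = i' then pairWeight B κ l i l' else 0) +
        (if l = l' then pairWeight B κ l i i' else 0)) := by
  obtain ⟨hB, hκ⟩ := hg.bound_nonneg
  have hw := fun a b c : Fin n => pairWeight_nonneg hB hκ a b c
  have hnn : ∀ (q : Prop) [Decidable q] (a b c : Fin n),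
      0 ≤ if q then pairWeight B κ a b c else 0 := fun q _ a b c => by
    split_ifs
    · exact hw a b c
    · exact le_rfl
  have hcov := (le_abs_self _).trans (hg.abs_covariance_le hF hFg i l i' l')
  have n1 := hnn (i = i') i l l'
  have n2 := hnn (i = l') i l i'
  have n3 := hnn (l = i') l i l'
  have n4 := hnn (l = l') l i i'
  have key : ∀ a b c, ∫ D, g (D a) (D b) * g (D a) (D c) ∂(Measure.pi fun _ : Fin n => P) +
      (∫ D, g (D a) (D b) ∂(Measure.pi fun _ : Fin n => P)) *
        ∫ D, g (D a) (D c) ∂(Measure.pi fun _ : Fin n => P) ≤ 2 * pairWeight B κ a b c :=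
    fun a b c => by linarith [hg.integral_mul_le a b c, hg.integral_mul_integral_le a b c]
  by_cases e1 : i = i'
  · subst e1
    rw [if_pos rfl] at n1 ⊢
    linarith [key i l l']
  by_cases e2 : i = l'
  · subst e2
    simp_rw [fun D : Fin n → Ω => hg.symm (D i') (D i)] at hcov
    rw [if_pos rfl] at n2 ⊢
    linarith [key i l i']
  by_cases e3 : l = i'
  · subst e3
    simp_rw [fun D : Fin n → Ω => hg.symm (D i) (D l)] at hcov
    rw [if_pos rfl] at n3 ⊢
    linarith [key l i l']
  by_cases e4 : l = l'
  · subst e4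
    simp_rw [fun D : Fin n → Ω => hg.symm (D i) (D l),
      fun D : Fin n → Ω => hg.symm (D i') (D l)] at hcov
    rw [if_pos rfl] at n4 ⊢
    linarith [key l i i']
  have hind := (iIndepFun_eval n P).indepFun_prodMk_prodMk (fun i => measurable_pi_apply i)
    i l i' l' e1 e2 e3 e4
  have h0 := (hind.comp hF hF).covariance_eq_zero (hg.memLp_of_abs_le hF hFg i l)
    (hg.memLp_of_abs_le hF hFg i' l')
  refine (le_of_eq h0).trans ?_
  linarith

lemma variance_le (hg : BoundedPairKernel P G B κ g) (hF : Measurable (Function.uncurry F))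
    (hFg : ∀ o ∈ G, ∀ o' ∈ G, |F o o'| ≤ g o o') (hn : 1 ≤ n) :
    Var[fun D : Fin n → Ω => (1 / (n : ℝ)) ^ 2 * ∑ i, ∑ l, F (D i) (D l);
      Measure.pi fun _ : Fin n => P] ≤
      8 * (B ^ 2 / n + 3 * (B * κ) / n ^ 2 + κ ^ 2 / n ^ 3) := by
  have hn0 : (n : ℝ) ≠ 0 := by positivity
  have hpair : (fun D : Fin n → Ω => ∑ i, ∑ l, F (D i) (D l)) =
      fun D => ∑ q : Fin n × Fin n, F (D q.1) (D q.2) := by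
    ext D; rw [Fintype.sum_prod_type]
  have hsum : Var[fun D : Fin n → Ω => ∑ i, ∑ l, F (D i) (D l);
      Measure.pi fun _ : Fin n => P] ≤
      8 * (n ^ 3 * B ^ 2 + 3 * n ^ 2 * (B * κ) + n * κ ^ 2) := by
    rw [hpair, variance_fun_sum (X := fun (q : Fin n × Fin n) (D : Fin n → Ω) => F (D q.1) (D q.2))
      fun q => hg.memLp_of_abs_le hF hFg q.1 q.2]
    refine (Finset.sum_le_sum fun q _ => Finset.sum_le_sum fun q' _ =>
      hg.covariance_le hF hFg q.1 q.2 q'.1 q'.2).trans (le_of_eq ?_)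
    simp_rw [Fintype.sum_prod_type, ← Finset.mul_sum, Finset.sum_add_distrib]
    have s1 : ∑ i : Fin n, ∑ l : Fin n, ∑ i', ∑ l', (if i = i' then pairWeight B κ i l l' else 0) =
        ∑ a : Fin n, ∑ b : Fin n, ∑ c : Fin n, pairWeight B κ a b c := by
      refine Finset.sum_congr rfl fun i _ => Finset.sum_congr rfl fun l _ => ?_
      rw [Finset.sum_comm]
      simp
    have s2 : ∑ i : Fin n, ∑ l : Fin n, ∑ i', ∑ l', (if i = l' then pairWeight B κ i l i' else 0) =
        ∑ a : Fin n, ∑ b : Fin n, ∑ c : Fin n, pairWeight B κ a b c := by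
      simp
    have s3 : ∑ i : Fin n, ∑ l : Fin n, ∑ i', ∑ l', (if l = i' then pairWeight B κ l i l' else 0) =
        ∑ a : Fin n, ∑ b : Fin n, ∑ c : Fin n, pairWeight B κ a b c := by
      rw [Finset.sum_comm]
      refine Finset.sum_congr rfl fun i _ => Finset.sum_congr rfl fun l _ => ?_
      rw [Finset.sum_comm]
      simp
    have s4 : ∑ i : Fin n, ∑ l : Fin n, ∑ i', ∑ l', (if l = l' then pairWeight B κ l i i' else 0) =
        ∑ a : Fin n, ∑ b : Fin n, ∑ c : Fin n, pairWeight B κ a b c := by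
      rw [Finset.sum_comm]
      simp
    rw [s1, s2, s3, s4, sum_pairWeight]
    ring
  rw [variance_const_mul]
  refine (mul_le_mul_of_nonneg_left hsum (by positivity)).trans (le_of_eq ?_)
  field_simp

end BoundedPairKernel

end PairAverage

section VarianceBound

variable {S d n : ℕ} (W : CDVBasis S) {P : Measure (Obs d)} {C : ℝ} {p b : (Fin d → ℝ) → ℝ}

lemma RegressionLaw.boundedPairKernel (h : RegressionLaw P C p b) {B : ℝ} (j : ℕ)
    (hK : ∀ x ∈ cube d, ∀ y ∈ cube d, |W.kernel j x y| ≤ B * resolution d j)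
    (hI : ∀ x ∈ cube d, ∫ y in cube d, |W.kernel j x y| ≤ B) :
    BoundedPairKernel P (boundedObs d C) (C ^ 2 * (1 + B)) (C ^ 2 * (1 + B * resolution d j))
      fun o o' => C ^ 2 * (1 + |W.kernel j (obsX o) (obsX o')|) where
  ae_mem := h.ae_mem_boundedObs
  measurable := by
    unfold Function.uncurry
    have : Measurable fun q : Obs d × Obs d => W.kernel j (obsX q.1) (obsX q.2) := by fun_prop
    exact (this.abs.const_add 1).const_mul _
  symm o o' := by rw [W.kernel_comm]
  nonneg o o' := by positivity
  le_bound o ho o' ho' := by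
    gcongr
    exact hK _ ho.1 _ ho'.1
  integral_le o ho := by
    have := h.isProbabilityMeasure
    have hc : Continuous fun y => |W.kernel j (obsX o) y| := by fun_prop
    rw [h.integral_comp_obsX (g := fun y => C ^ 2 * (1 + |W.kernel j (obsX o) y|))
      (by fun_prop), integral_const_mul, integral_add (integrable_const _)
      (ContinuousOn.integrableOn_cube hc.continuousOn)]
    have h1 : ∫ _y in cube d, (1 : ℝ) = 1 := by simp
    rw [h1]
    gcongr
    exact hI _ ho.1

lemma exists_variance_psiNR_le (d : ℕ) (C : ℝ) : ∃ V, 0 < V ∧ ∀ (P : Measure (Obs d))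
    (p b : (Fin d → ℝ) → ℝ), RegressionLaw P C p b → ∀ n : ℕ, 1 ≤ n → ∀ j : ℕ,
      Var[fun D => psiNR W j D; sampleLaw n P] ≤ V * varRate d n j := by
  obtain ⟨B₁, hB₁, hK⟩ := W.exists_abs_kernel_le d
  obtain ⟨B₂, hB₂, hI⟩ := W.exists_integral_abs_kernel_le d
  set B := max B₁ B₂
  have hB : 1 ≤ B := hB₁.trans (le_max_left _ _)
  refine ⟨1 + 96 * (C ^ 4 * B ^ 2), by positivity, fun P p b h n hn j => ?_⟩
  have := h.isProbabilityMeasure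
  have hk := one_le_resolution d j
  have hn1 : (1 : ℝ) ≤ n := by exact_mod_cast hn
  have hg := h.boundedPairKernel W (B := B) j
    (fun x hx y hy => (hK j x hx y hy).trans
      (mul_le_mul_of_nonneg_right (le_max_left _ _) (by linarith)))
    (fun x hx => (hI j x hx).trans (le_max_right _ _))
  have hv := hg.variance_le (n := n) (F := fun o o' => pairTerm W j o o')
    (by unfold Function.uncurry; exact measurable_pairTerm W j measurable_fst measurable_snd)
    (fun o ho o' ho' => abs_pairTerm_le W ho ho' j) hn
  simp_rw [psiNR_eq_sum_pairTerm W hn]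
  refine hv.trans ?_
  have e1 : 1 + B ≤ 2 * B := by linarith
  have e2 : 1 + B * resolution d j ≤ 2 * (B * resolution d j) := by nlinarith
  calc _ ≤ 8 * ((C ^ 2 * (2 * B)) ^ 2 / n + 3 * ((C ^ 2 * (2 * B)) *
        (C ^ 2 * (2 * (B * resolution d j)))) / n ^ 2 +
        (C ^ 2 * (2 * (B * resolution d j))) ^ 2 / n ^ 3) := by gcongr
    _ = 32 * (C ^ 4 * B ^ 2) * (1 / n) + 96 * (C ^ 4 * B ^ 2) * (resolution d j / n ^ 2) +
        32 * (C ^ 4 * B ^ 2) * (resolution d j ^ 2 / n ^ 3) := by ring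
    _ ≤ (1 + 96 * (C ^ 4 * B ^ 2)) * (1 / n) +
        (1 + 96 * (C ^ 4 * B ^ 2)) * (resolution d j / n ^ 2) +
        (1 + 96 * (C ^ 4 * B ^ 2)) * (resolution d j ^ 2 / n ^ 3) := by
        have : 0 ≤ C ^ 4 * B ^ 2 := by positivity
        gcongr <;> linarith
    _ = _ := by rw [varRate]; ring

end VarianceBound

/-! ### Perturbations at a single resolution level -/

namespace CDVBasis

variable {S : ℕ} (W : CDVBasis S) {d : ℕ}

lemma holderNorm_add_le (α : ℝ) {h f : (Fin d → ℝ) → ℝ} (hh : ContinuousOn h (cube d))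
    (hf : ContinuousOn f (cube d)) :
    W.holderNorm α (fun x => h x + f x) ≤ W.holderNorm α h + W.holderNorm α f := by
  have key : ∀ (c : ℝ) (g : (Fin d → ℝ) → ℝ), 0 ≤ c → Continuous g →
      ENNReal.ofReal (c * |∫ x in cube d, (h x + f x) * g x|) ≤
        ENNReal.ofReal (c * |∫ x in cube d, h x * g x|) +
          ENNReal.ofReal (c * |∫ x in cube d, f x * g x|) := by
    intro c g hc hg
    simp_rw [add_mul]
    rw [integral_add (ContinuousOn.integrableOn_cube (by fun_prop))
      (ContinuousOn.integrableOn_cube (by fun_prop)), ← ENNReal.ofReal_add (by positivity)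
      (by positivity), ← mul_add]
    exact ENNReal.ofReal_le_ofReal (mul_le_mul_of_nonneg_left (abs_add_le _ _) hc)
  unfold holderNorm
  rw [add_add_add_comm]
  refine add_le_add ?_ ?_
  · refine iSup_le fun m => (key _ _ (by positivity) (W.continuous_Phi _ m)).trans ?_
    exact add_le_add (le_iSup_of_le m le_rfl) (le_iSup_of_le m le_rfl)
  · refine iSup_le fun l => iSup_le fun hl => iSup_le fun m => iSup_le fun ι => iSup_le fun hι =>
      (key _ _ (by positivity) (W.continuous_Psi ι l m)).trans ?_
    exact add_le_add
      (le_iSup_of_le l (le_iSup_of_le hl (le_iSup_of_le m (le_iSup_of_le ι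
        (le_iSup_of_le hι le_rfl)))))
      (le_iSup_of_le l (le_iSup_of_le hl (le_iSup_of_le m (le_iSup_of_le ι
        (le_iSup_of_le hι le_rfl)))))

lemma add_mem_holderBall {α M τ : ℝ} (hM : 0 ≤ M) (hτ : 0 ≤ τ) {h f : (Fin d → ℝ) → ℝ}
    (hh : h ∈ W.holderBall d α M) (hf : f ∈ W.holderBall d α τ) :
    (fun x => h x + f x) ∈ W.holderBall d α (M + τ) := by
  refine ⟨hh.1.add hf.1, (W.holderNorm_add_le α hh.1 hf.1).trans ?_⟩
  rw [ENNReal.ofReal_add hM hτ]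
  exact add_le_add hh.2 hf.2

lemma holderBall_mono {α M M' : ℝ} (hM : M ≤ M') : W.holderBall d α M ⊆ W.holderBall d α M' :=
  fun _ hh => ⟨hh.1, hh.2.trans (ENNReal.ofReal_le_ofReal hM)⟩

lemma mem_holderBall_congr {α M : ℝ} {h f : (Fin d → ℝ) → ℝ} (hf : h ∈ W.holderBall d α M)
    (he : EqOn f h (cube d)) : f ∈ W.holderBall d α M := by
  have e : ∀ g : (Fin d → ℝ) → ℝ, ∫ x in cube d, f x * g x = ∫ x in cube d, h x * g x := fun g =>
    setIntegral_congr_fun (measurableSet_cube d) fun x hx => by simp only [he hx]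
  refine ⟨hf.1.congr he, le_trans (le_of_eq ?_) hf.2⟩
  simp only [holderNorm, e]

/-- The sum of all the tensor wavelets of level `j` with the wavelet in every coordinate. -/
noncomputable def waveletSum (d j : ℕ) (x : Fin d → ℝ) : ℝ := ∑ m, W.Psi (fun _ => true) j m x

@[fun_prop]
lemma continuous_waveletSum (d j : ℕ) : Continuous (W.waveletSum d j) := by
  unfold waveletSum; fun_prop

lemma integral_waveletSum_mul {g : (Fin d → ℝ) → ℝ} (hg : Continuous g) (j : ℕ) :
    ∫ x in cube d, W.waveletSum d j x * g x =
      ∑ m, ∫ x in cube d, W.Psi (fun _ => true) j m x * g x := by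
  simp only [waveletSum, Finset.sum_mul]
  rw [integral_finsetSum _ fun m _ => ContinuousOn.integrableOn_cube (by fun_prop)]

lemma integral_Psi_true_mul_Phi (hd : 1 ≤ d) {l j : ℕ} (hl : W.J₀ ≤ l) (hlj : l ≤ j)
    (m : Fin d → Fin (2 ^ j)) (m' : Fin d → Fin (2 ^ l)) :
    ∫ x in cube d, W.Psi (fun _ => true) j m x * W.Phi l m' x = 0 := by
  rw [Phi_eq_Psi, integral_Psi_mul_Psi]
  refine Finset.prod_eq_zero (Finset.mem_univ ⟨0, hd⟩) ?_
  simpa using W.integral_wavelet_mul_scaling hl hlj (m ⟨0, hd⟩) (m' ⟨0, hd⟩)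

lemma integral_Psi_true_mul_Psi_of_ne {l j : ℕ} (hl : W.J₀ ≤ l) (hj : W.J₀ ≤ j)
    {ι : Fin d → Bool} (hι : ι ≠ fun _ => false) (hne : l ≠ j ∨ ι ≠ fun _ => true)
    (m : Fin d → Fin (2 ^ j)) (m' : Fin d → Fin (2 ^ l)) :
    ∫ x in cube d, W.Psi (fun _ => true) j m x * W.Psi ι l m' x = 0 := by
  rw [integral_Psi_mul_Psi]
  simp only [if_true]
  -- A coordinate with the wavelet settles different levels, one with the scaling function the
  -- same level.
  by_cases hlj : l = j
  · obtain ⟨i, hi⟩ := Function.ne_iff.mp (hne.resolve_left fun h => h hlj)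
    refine Finset.prod_eq_zero (Finset.mem_univ i) ?_
    simp only [if_neg hi]
    exact W.integral_wavelet_mul_scaling hl hlj.le (m i) (m' i)
  · obtain ⟨i, hi⟩ := Function.ne_iff.mp hι
    refine Finset.prod_eq_zero (Finset.mem_univ i) ?_
    have hi : ι i = true := by simpa using hi
    simp only [if_pos hi]
    exact W.integral_wavelet_mul_wavelet_of_ne hl hj hlj (m i) (m' i)

lemma integral_Psi_true_mul_Psi_true {j : ℕ} (hj : W.J₀ ≤ j) (m m' : Fin d → Fin (2 ^ j)) :
    ∫ x in cube d, W.Psi (fun _ => true) j m x * W.Psi (fun _ => true) j m' x =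
      if m = m' then 1 else 0 := by
  rw [integral_Psi_mul_Psi]
  simp only [if_true]
  simp_rw [W.integral_wavelet_mul_wavelet hj, Finset.prod_ite_zero, funext_iff]
  simp

lemma scalingCoeff_waveletSum (hd : 1 ≤ d) {l j : ℕ} (hl : W.J₀ ≤ l) (hlj : l ≤ j)
    (m : Fin d → Fin (2 ^ l)) : W.scalingCoeff l (W.waveletSum d j) m = 0 := by
  rw [scalingCoeff, integral_waveletSum_mul _ (W.continuous_Phi l m)]
  exact Finset.sum_eq_zero fun m' _ => W.integral_Psi_true_mul_Phi hd hl hlj m' m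

lemma integral_waveletSum_sq {j : ℕ} (hj : W.J₀ ≤ j) :
    ∫ x in cube d, W.waveletSum d j x * W.waveletSum d j x = resolution d j := by
  rw [W.integral_waveletSum_mul (W.continuous_waveletSum d j)]
  have : ∀ m, ∫ x in cube d, W.Psi (fun _ => true) j m x * W.waveletSum d j x = 1 := by
    intro m
    simp_rw [mul_comm (W.Psi (fun _ => true) j m _)]
    rw [W.integral_waveletSum_mul (W.continuous_Psi _ j m)]
    simp_rw [W.integral_Psi_true_mul_Psi_true hj]
    simp
  simp_rw [this]
  simp [resolution_eq]

lemma smul_waveletSum_mem_holderBall (hd : 1 ≤ d) {j : ℕ} (hj : W.J₀ ≤ j) (α : ℝ) {a τ : ℝ}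
    (ha : |a| * (2 : ℝ) ^ ((j : ℝ) * (α + d / 2)) ≤ τ) :
    (fun x => a * W.waveletSum d j x) ∈ W.holderBall d α τ := by
  refine ⟨by fun_prop, ?_⟩
  have h1 : ∀ m : Fin d → Fin (2 ^ W.J₀),
      ∫ x in cube d, a * W.waveletSum d j x * W.Phi W.J₀ m x = 0 := by
    intro m
    simp_rw [mul_assoc, integral_const_mul]
    exact mul_eq_zero_of_right _ (W.scalingCoeff_waveletSum hd le_rfl hj m)
  unfold holderNorm
  simp_rw [h1, abs_zero, mul_zero, ENNReal.ofReal_zero, ciSup_const, zero_add]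
  refine iSup_le fun l => iSup_le fun hl => iSup_le fun m => iSup_le fun ι => iSup_le fun hι =>
    ENNReal.ofReal_le_ofReal ?_
  simp_rw [mul_assoc, integral_const_mul]
  rw [W.integral_waveletSum_mul (W.continuous_Psi ι l m)]
  have hτ : 0 ≤ τ := le_trans (by positivity) ha
  by_cases hne : l ≠ j ∨ ι ≠ fun _ => true
  · simp_rw [W.integral_Psi_true_mul_Psi_of_ne hl hj hι hne]
    simpa using hτ
  · push Not at hne
    obtain ⟨rfl, rfl⟩ := hne
    simp_rw [W.integral_Psi_true_mul_Psi_true hj]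
    simpa [mul_comm] using ha

lemma abs_waveletSum_le {A : ℝ} {j : ℕ} {x : Fin d → ℝ}
    (hA : ∑ m, |W.Psi (fun _ => true) j m x| ≤ A * (2 : ℝ) ^ ((j : ℝ) * (d / 2))) :
    |W.waveletSum d j x| ≤ A * (2 : ℝ) ^ ((j : ℝ) * (d / 2)) :=
  (Finset.abs_sum_le_sum_abs _ _).trans hA

end CDVBasis

/-! ### Two-point laws -/

section TwoPointLaw

variable {d : ℕ}

/-- The law of `(X, p(X) + sε, b(X) + sη)` for `X` uniform on the cube and an independent random
sign `s`: the regression functions are `p` and `b`, and the conditional covariance is `ε η`. -/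
noncomputable def twoPointLaw (p b : (Fin d → ℝ) → ℝ) (ε η : ℝ) : Measure (Obs d) :=
  (2⁻¹ : ℝ≥0∞) • (volume.restrict (cube d)).map (fun x => (x, p x + ε, b x + η)) +
    (2⁻¹ : ℝ≥0∞) • (volume.restrict (cube d)).map (fun x => (x, p x - ε, b x - η))

variable {p b : (Fin d → ℝ) → ℝ} {ε η : ℝ}

lemma isProbabilityMeasure_twoPointLaw (hp : Measurable p) (hb : Measurable b) :
    IsProbabilityMeasure (twoPointLaw p b ε η) := by
  have h1 : IsProbabilityMeasure ((volume.restrict (cube d)).map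
      (fun x => (x, p x + ε, b x + η))) :=
    Measure.isProbabilityMeasure_map (Measurable.aemeasurable (by fun_prop))
  have h2 : IsProbabilityMeasure ((volume.restrict (cube d)).map
      (fun x => (x, p x - ε, b x - η))) :=
    Measure.isProbabilityMeasure_map (Measurable.aemeasurable (by fun_prop))
  refine ⟨?_⟩
  simp [twoPointLaw, ENNReal.inv_two_add_inv_two]

lemma map_obsX_twoPointLaw (hp : Measurable p) (hb : Measurable b) :
    (twoPointLaw p b ε η).map obsX = volume.restrict (cube d) := by
  have h1 : (fun o => obsX o) ∘ (fun x : Fin d → ℝ => ((x, p x + ε, b x + η) : Obs d)) = id := rfl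
  have h2 : (fun o => obsX o) ∘ (fun x : Fin d → ℝ => ((x, p x - ε, b x - η) : Obs d)) = id := rfl
  rw [twoPointLaw, Measure.map_add _ _ measurable_obsX, Measure.map_smul, Measure.map_smul,
    Measure.map_map measurable_obsX (by fun_prop), Measure.map_map measurable_obsX (by fun_prop)]
  change (2⁻¹ : ℝ≥0∞) • Measure.map id _ + (2⁻¹ : ℝ≥0∞) • Measure.map id _ = _
  rw [Measure.map_id, ← add_smul, ENNReal.inv_two_add_inv_two, one_smul]

lemma ae_twoPointLaw (hp : Measurable p) (hb : Measurable b) {Q : Obs d → Prop}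
    (hQ : MeasurableSet {o | Q o})
    (h1 : ∀ᵐ x ∂volume.restrict (cube d), Q (x, p x + ε, b x + η))
    (h2 : ∀ᵐ x ∂volume.restrict (cube d), Q (x, p x - ε, b x - η)) :
    ∀ᵐ o ∂twoPointLaw p b ε η, Q o := by
  rw [twoPointLaw, ae_add_measure_iff]
  constructor
  · exact Measure.ae_smul_measure ((ae_map_iff (Measurable.aemeasurable (by fun_prop)) hQ).mpr h1) _
  · exact Measure.ae_smul_measure ((ae_map_iff (Measurable.aemeasurable (by fun_prop)) hQ).mpr h2) _

lemma integral_twoPointLaw (hp : Measurable p) (hb : Measurable b) {f : Obs d → ℝ}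
    (hf : Measurable f)
    (h1 : Integrable (fun x => f (x, p x + ε, b x + η)) (volume.restrict (cube d)))
    (h2 : Integrable (fun x => f (x, p x - ε, b x - η)) (volume.restrict (cube d))) :
    ∫ o, f o ∂twoPointLaw p b ε η =
      ∫ x in cube d, 2⁻¹ * (f (x, p x + ε, b x + η) + f (x, p x - ε, b x - η)) := by
  have m1 : Measurable fun x : Fin d → ℝ => ((x, p x + ε, b x + η) : Obs d) := by fun_prop
  have m2 : Measurable fun x : Fin d → ℝ => ((x, p x - ε, b x - η) : Obs d) := by fun_prop
  have i1 := (integrable_map_measure (μ := volume.restrict (cube d)) hf.aestronglyMeasurable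
    m1.aemeasurable).mpr h1
  have i2 := (integrable_map_measure (μ := volume.restrict (cube d)) hf.aestronglyMeasurable
    m2.aemeasurable).mpr h2
  rw [twoPointLaw, integral_add_measure (i1.smul_measure (by simp)) (i2.smul_measure (by simp)),
    integral_smul_measure, integral_smul_measure,
    integral_map m1.aemeasurable hf.aestronglyMeasurable,
    integral_map m2.aemeasurable hf.aestronglyMeasurable, integral_const_mul, integral_add h1 h2]
  simp
  ring

/-- The regression function of a response is its average over the two signs. -/
lemma condExp_twoPointLaw (hp : Measurable p) (hb : Measurable b) {V : Obs d → ℝ}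
    {q : (Fin d → ℝ) → ℝ} (hV : Measurable V) (hq : Measurable q) {C : ℝ}
    (h1 : ∀ᵐ x ∂volume.restrict (cube d), |V (x, p x + ε, b x + η)| ≤ C)
    (h2 : ∀ᵐ x ∂volume.restrict (cube d), |V (x, p x - ε, b x - η)| ≤ C)
    (hVq : ∀ x, 2⁻¹ * (V (x, p x + ε, b x + η) + V (x, p x - ε, b x - η)) = q x) :
    (twoPointLaw p b ε η)[V | sigmaX d] =ᵐ[twoPointLaw p b ε η] fun o => q (obsX o) := by
  have := isProbabilityMeasure_twoPointLaw (ε := ε) (η := η) hp hb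
  have hqC : ∀ᵐ x ∂volume.restrict (cube d), |q x| ≤ C := by
    filter_upwards [h1, h2] with x h1 h2
    rw [← hVq, abs_mul, abs_of_pos (by norm_num : (0 : ℝ) < 2⁻¹)]
    linarith [abs_add_le (V (x, p x + ε, b x + η)) (V (x, p x - ε, b x - η))]
  have hint : ∀ f : Obs d → ℝ, Measurable f → (∀ᵐ o ∂twoPointLaw p b ε η, |f o| ≤ C) →
      Integrable f (twoPointLaw p b ε η) := fun f hf hfC =>
    Integrable.of_bound hf.aestronglyMeasurable C hfC
  have hVi := hint V hV (ae_twoPointLaw hp hb (measurableSet_le hV.abs measurable_const) h1 h2)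
  have hqm : Measurable fun o : Obs d => q (obsX o) := hq.comp measurable_obsX
  have hqi := hint (fun o => q (obsX o)) hqm
    (ae_twoPointLaw hp hb (measurableSet_le hqm.abs measurable_const) hqC hqC)
  have hint' : ∀ (f : (Fin d → ℝ) → ℝ) (t : Set (Fin d → ℝ)), MeasurableSet t → Measurable f →
      (∀ᵐ x ∂volume.restrict (cube d), |f x| ≤ C) →
      Integrable (t.indicator f) (volume.restrict (cube d)) := fun f t ht hf hfC =>
    (Integrable.of_bound hf.aestronglyMeasurable C hfC).indicator ht
  symm
  refine ae_eq_condExp_of_forall_setIntegral_eq sigmaX_le hVi (fun s _ _ => hqi.integrableOn) ?_ ?_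
  · rintro s ⟨t, ht, rfl⟩ -
    have hs : MeasurableSet (obsX ⁻¹' t : Set (Obs d)) := measurable_obsX ht
    rw [← integral_indicator hs, ← integral_indicator hs,
      integral_twoPointLaw hp hb (hqm.indicator hs) (hint' q t ht hq hqC) (hint' q t ht hq hqC),
      integral_twoPointLaw hp hb (hV.indicator hs)
        (hint' (fun x => V (x, p x + ε, b x + η)) t ht (hV.comp (by fun_prop)) h1)
        (hint' (fun x => V (x, p x - ε, b x - η)) t ht (hV.comp (by fun_prop)) h2)]
    refine integral_congr_ae (ae_of_all _ fun x => ?_)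
    by_cases hx : x ∈ t
    · simp only [indicator, mem_preimage, obsX, hx, if_true]
      rw [hVq]; ring
    · simp [indicator, obsX, hx]
  · exact (hq.comp (comap_measurable obsX)).stronglyMeasurable.aestronglyMeasurable

variable {S : ℕ} {W : CDVBasis S} {α β M C₁ C₂ : ℝ}

lemma isModelLaw_twoPointLaw (hp : Measurable p) (hb : Measurable b)
    (hpM : p ∈ W.holderBall d α M) (hbM : b ∈ W.holderBall d β M)
    (hpC : ∀ᵐ x ∂volume.restrict (cube d), p x ∈ Icc (C₁ + |ε|) (C₂ - |ε|))
    (hbC : ∀ᵐ x ∂volume.restrict (cube d), b x ∈ Icc (C₁ + |η|) (C₂ - |η|)) :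
    IsModelLaw W α β M C₁ C₂ (twoPointLaw p b ε η) ∧
      RegressionLaw (twoPointLaw p b ε η) (max |C₁| |C₂|) p b := by
  have hA1 : ∀ᵐ x ∂volume.restrict (cube d), p x + ε ∈ Icc C₁ C₂ := by
    filter_upwards [hpC] with x hx
    constructor <;> linarith [hx.1, hx.2, le_abs_self ε, neg_abs_le ε]
  have hA2 : ∀ᵐ x ∂volume.restrict (cube d), p x - ε ∈ Icc C₁ C₂ := by
    filter_upwards [hpC] with x hx
    constructor <;> linarith [hx.1, hx.2, le_abs_self ε, neg_abs_le ε]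
  have hY1 : ∀ᵐ x ∂volume.restrict (cube d), b x + η ∈ Icc C₁ C₂ := by
    filter_upwards [hbC] with x hx
    constructor <;> linarith [hx.1, hx.2, le_abs_self η, neg_abs_le η]
  have hY2 : ∀ᵐ x ∂volume.restrict (cube d), b x - η ∈ Icc C₁ C₂ := by
    filter_upwards [hbC] with x hx
    constructor <;> linarith [hx.1, hx.2, le_abs_self η, neg_abs_le η]
  have hbd : ∀ {f : (Fin d → ℝ) → ℝ}, (∀ᵐ x ∂volume.restrict (cube d), f x ∈ Icc C₁ C₂) →
      ∀ᵐ x ∂volume.restrict (cube d), |f x| ≤ max |C₁| |C₂| := fun h => by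
    filter_upwards [h] with x hx using abs_le_max_abs_abs hx.1 hx.2
  have hcA : (twoPointLaw p b ε η)[obsA | sigmaX d] =ᵐ[twoPointLaw p b ε η]
      fun o => p (obsX o) :=
    condExp_twoPointLaw hp hb measurable_obsA hp (hbd hA1) (hbd hA2) fun x => by
      simp only [obsA]; ring
  have hcY : (twoPointLaw p b ε η)[obsY | sigmaX d] =ᵐ[twoPointLaw p b ε η]
      fun o => b (obsX o) :=
    condExp_twoPointLaw hp hb measurable_obsY hb (hbd hY1) (hbd hY2) fun x => by
      simp only [obsY]; ring
  have hmodel : IsModelLaw W α β M C₁ C₂ (twoPointLaw p b ε η) :=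
    { isProbabilityMeasure := isProbabilityMeasure_twoPointLaw hp hb
      uniform := map_obsX_twoPointLaw hp hb
      bounded_A := ae_twoPointLaw hp hb (measurable_obsA measurableSet_Icc) hA1 hA2
      bounded_Y := ae_twoPointLaw hp hb (measurable_obsY measurableSet_Icc) hY1 hY2
      holder_p := ⟨p, hpM, hcA⟩
      holder_b := ⟨b, hbM, hcY⟩ }
  refine ⟨hmodel, hmodel.isProbabilityMeasure, hmodel.uniform, ?_, ?_, hpM.1, hbM.1, hcA, hcY⟩
  · filter_upwards [hmodel.bounded_A] with o ho using abs_le_max_abs_abs ho.1 ho.2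
  · filter_upwards [hmodel.bounded_Y] with o ho using abs_le_max_abs_abs ho.1 ho.2

lemma integral_A_mul_Y_mul_kernel_twoPointLaw (hp : Measurable p) (hb : Measurable b)
    (hpc : ContinuousOn p (cube d)) (hbc : ContinuousOn b (cube d)) {j : ℕ} (hj : W.J₀ ≤ j) :
    ∫ o, obsA o * obsY o * W.kernel j (obsX o) (obsX o) ∂twoPointLaw p b ε η =
      (∫ x in cube d, p x * b x * W.kernel j x x) + ε * η * resolution d j := by
  have hk : Continuous fun x : Fin d → ℝ => W.kernel j x x := by fun_prop
  rw [integral_twoPointLaw hp hb (by fun_prop)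
    (ContinuousOn.integrableOn_cube (by simp only [obsA, obsY, obsX]; fun_prop))
    (ContinuousOn.integrableOn_cube (by simp only [obsA, obsY, obsX]; fun_prop)),
    ← W.integral_kernel_self hj, ← integral_const_mul, ← integral_add
    (ContinuousOn.integrableOn_cube (by fun_prop)) (ContinuousOn.integrableOn_cube (by fun_prop))]
  refine integral_congr_ae (ae_of_all _ fun x => ?_)
  simp only [obsA, obsY, obsX]
  ring

/-- The bias under a two-point law. -/
lemma integral_psiNR_sub_twoPointLaw {n : ℕ} (hn : 1 ≤ n) (hp : Measurable p) (hb : Measurable b)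
    {C : ℝ} (h : RegressionLaw (twoPointLaw p b ε η) C p b) {j : ℕ} (hj : W.J₀ ≤ j) :
    ∫ D, (psiNR W j D - expCondCov (twoPointLaw p b ε η)) ∂sampleLaw n (twoPointLaw p b ε η) =
      (∫ x in cube d, p x * b x * (1 - W.kernel j x x / n)) -
        (1 - 1 / n) * ∑ m, W.scalingCoeff j p m * W.scalingCoeff j b m -
        ε * η * (resolution d j / n) := by
  have hk : Continuous fun x : Fin d → ℝ => W.kernel j x x := by fun_prop
  have hpc := h.continuousOn_p
  have hbc := h.continuousOn_b
  rw [h.integral_psiNR_sub W hn, integral_A_mul_Y_mul_kernel_twoPointLaw hp hb hpc hbc hj]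
  have : ∫ x in cube d, p x * b x * (1 - W.kernel j x x / n) =
      (∫ x in cube d, p x * b x) - 1 / n * ∫ x in cube d, p x * b x * W.kernel j x x := by
    rw [← integral_const_mul, ← integral_sub (ContinuousOn.integrableOn_cube (by fun_prop))
      (ContinuousOn.integrableOn_cube (by fun_prop))]
    exact integral_congr_ae (ae_of_all _ fun x => by ring)
  rw [this]
  ring

end TwoPointLaw

/-! ### Bounds for the worst-case bias and variance -/

section Bounds

variable {S d : ℕ} (W : CDVBasis S) {α β M C₁ C₂ : ℝ}

lemma resolution_rpow (hd : 1 ≤ d) (γ : ℝ) (j : ℕ) :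
    resolution d j ^ (-γ / (d : ℝ)) = ((2 : ℝ) ^ (-γ)) ^ j := by
  have hd0 : (d : ℝ) ≠ 0 := by positivity
  rw [resolution, ← Real.rpow_natCast, ← Real.rpow_mul two_pos.le, ← Real.rpow_natCast,
    ← Real.rpow_mul two_pos.le]
  congr 1
  push_cast
  field_simp

lemma exists_abs_bias_le (hS : 0 < S) (hd : 1 ≤ d) (hα : 0 < α) (hβ : 0 < β) (hM : 0 ≤ M)
    (C₁ C₂ : ℝ) : ∃ C, 0 < C ∧ ∀ n : ℕ, 1 ≤ n → ∀ j, W.J₀ ≤ j → ∀ P : Measure (Obs d),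
      IsModelLaw W α β M C₁ C₂ P →
        |∫ D, (psiNR W j D - expCondCov P) ∂sampleLaw n P| ≤ C * biasRate d α β n j := by
  obtain ⟨A, hA, happrox⟩ := W.exists_abs_integral_mul_sub_le d hS hα hβ hM
  obtain ⟨B, hB, hK⟩ := W.exists_abs_kernel_le d
  obtain ⟨B', hB', hsum⟩ := W.exists_abs_sum_scalingCoeff_mul_le d
  set D := max |C₁| |C₂|
  refine ⟨1 + A + (B + B') * D ^ 2, by positivity, fun n hn j hj P hP => ?_⟩
  obtain ⟨p, hp, b, hb, h⟩ := hP.exists_regressionLaw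
  have := h.isProbabilityMeasure
  have hk := one_le_resolution d j
  have hn0 : (0 : ℝ) < n := by exact_mod_cast hn
  have hdiag : |∫ o, obsA o * obsY o * W.kernel j (obsX o) (obsX o) ∂P| ≤
      B * D ^ 2 * resolution d j := by
    have := norm_integral_le_of_norm_le_const (μ := P)
      (f := fun o => obsA o * obsY o * W.kernel j (obsX o) (obsX o))
      (C := B * D ^ 2 * resolution d j) (by
        filter_upwards [h.ae_mem_boundedObs] with o ho
        rw [Real.norm_eq_abs, abs_mul, abs_mul]
        calc _ ≤ D * D * (B * resolution d j) :=
              mul_le_mul (mul_le_mul ho.2.1 ho.2.2 (abs_nonneg _) h.nonneg) (hK j _ ho.1 _ ho.1)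
                (abs_nonneg _) (mul_nonneg h.nonneg h.nonneg)
          _ = _ := by ring)
    simpa using this
  have h1 := happrox p hp b hb j hj
  have h2 := hsum D p b hp.1 hb.1 h.ae_abs_p_le h.ae_abs_b_le j
  have hr1 : ((2 : ℝ) ^ (-(α + β))) ^ j ≤ biasRate d α β n j := by
    rw [biasRate, resolution_rpow hd]; exact le_max_left _ _
  have hr2 : resolution d j / n ≤ biasRate d α β n j := le_max_right _ _
  rw [h.integral_psiNR_sub W hn]
  have h3 : |1 / (n : ℝ) * ((∫ o, obsA o * obsY o * W.kernel j (obsX o) (obsX o) ∂P) -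
        ∑ m, W.scalingCoeff j p m * W.scalingCoeff j b m)| ≤
      (B + B') * D ^ 2 * (resolution d j / n) := by
    rw [abs_mul, abs_of_pos (by positivity : (0 : ℝ) < 1 / n)]
    calc _ ≤ 1 / (n : ℝ) * (B * D ^ 2 * resolution d j + B' * D ^ 2 * resolution d j) := by
          refine mul_le_mul_of_nonneg_left ((abs_sub _ _).trans (add_le_add hdiag (h2.trans ?_)))
            (by positivity)
          exact le_mul_of_one_le_right (by positivity) hk
      _ = _ := by ring
  have hr0 : 0 ≤ resolution d j / n := div_nonneg (by linarith) hn0.le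
  calc _ ≤ A * ((2 : ℝ) ^ (-(α + β))) ^ j + (B + B') * D ^ 2 * (resolution d j / n) :=
        (abs_sub _ _).trans (add_le_add h1 h3)
    _ ≤ A * biasRate d α β n j + (B + B') * D ^ 2 * biasRate d α β n j := by gcongr
    _ ≤ _ := by nlinarith

variable {W}

lemma IsModelLaw.ofReal_abs_bias_le {P : Measure (Obs d)} (hP : IsModelLaw W α β M C₁ C₂ P)
    (n j : ℕ) : ENNReal.ofReal |∫ D, (psiNR W j D - expCondCov P) ∂sampleLaw n P| ≤
      supBiasNR W d α β M C₁ C₂ n j :=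
  le_iSup₂_of_le P hP le_rfl

/-- A non-degenerate model contains regression functions with room to be perturbed. -/
lemma exists_interior_regressions (hM : 0 < M) {C₁' C₂' M' : ℝ} (hC₁ : C₁ < C₁') (hC₂ : C₂' < C₂)
    (hM' : M' < M) {P : Measure (Obs d)} (hP : IsModelLaw W α β M' C₁' C₂' P) :
    ∃ ε τ M₀ : ℝ, 0 < ε ∧ 0 < τ ∧ 0 ≤ M₀ ∧ M₀ + τ ≤ M ∧ ∃ p b : (Fin d → ℝ) → ℝ,
      Measurable p ∧ Measurable b ∧ p ∈ W.holderBall d α M₀ ∧ b ∈ W.holderBall d β M₀ ∧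
      (∀ᵐ x ∂volume.restrict (cube d), p x ∈ Icc (C₁ + ε) (C₂ - ε)) ∧
      (∀ᵐ x ∂volume.restrict (cube d), b x ∈ Icc (C₁ + ε) (C₂ - ε)) := by
  classical
  obtain ⟨p, hp, b, hb, h⟩ := hP.exists_regressionLaw
  -- Cutting the regression functions off outside the cube makes them measurable; `M'` may be
  -- negative, hence the maximum with `0`.
  have hmeas : ∀ f : (Fin d → ℝ) → ℝ, ContinuousOn f (cube d) → Measurable ((cube d).indicator f) :=
    fun f hf => by
      rw [← Set.piecewise_eq_indicator]
      exact hf.measurable_piecewise continuousOn_const (measurableSet_cube d)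
  have hball : ∀ {γ : ℝ} {f : (Fin d → ℝ) → ℝ}, f ∈ W.holderBall d γ M' →
      (cube d).indicator f ∈ W.holderBall d γ (max M' 0) := fun hf =>
    W.mem_holderBall_congr (W.holderBall_mono (le_max_left _ _) hf) (eqOn_indicator)
  have hae : ∀ f : (Fin d → ℝ) → ℝ, (∀ᵐ x ∂volume.restrict (cube d), f x ∈ Icc C₁' C₂') →
      ∀ᵐ x ∂volume.restrict (cube d), (cube d).indicator f x ∈
        Icc (C₁ + min (C₁' - C₁) (C₂ - C₂')) (C₂ - min (C₁' - C₁) (C₂ - C₂')) := fun f hf => by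
    filter_upwards [hf, ae_restrict_mem (measurableSet_cube d)] with x hx hxc
    rw [indicator_of_mem hxc]
    constructor
    · linarith [hx.1, min_le_left (C₁' - C₁) (C₂ - C₂')]
    · linarith [hx.2, min_le_right (C₁' - C₁) (C₂ - C₂')]
  refine ⟨min (C₁' - C₁) (C₂ - C₂'), M - max M' 0, max M' 0, lt_min (by linarith) (by linarith),
    sub_pos.mpr (max_lt hM' hM), le_max_right _ _, by linarith, (cube d).indicator p,
    (cube d).indicator b, hmeas p hp.1, hmeas b hb.1, hball hp, hball hb, hae p ?_, hae b ?_⟩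
  · exact h.ae_mem_Icc_of_condExp h.integrable_A hP.bounded_A hp.1 h.condExp_A
  · exact h.ae_mem_Icc_of_condExp h.integrable_Y hP.bounded_Y hb.1 h.condExp_Y

/-- Two laws with the same regression functions and conditional covariances `± ε ^ 2` have biases
that differ by `2 ε ^ 2 k / n`. -/
lemma ofReal_mul_resolution_div_le_supBiasNR {ε : ℝ} (hε : 0 < ε) {p b : (Fin d → ℝ) → ℝ}
    (hp : Measurable p) (hb : Measurable b) (hpM : p ∈ W.holderBall d α M)
    (hbM : b ∈ W.holderBall d β M)
    (hpC : ∀ᵐ x ∂volume.restrict (cube d), p x ∈ Icc (C₁ + ε) (C₂ - ε))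
    (hbC : ∀ᵐ x ∂volume.restrict (cube d), b x ∈ Icc (C₁ + ε) (C₂ - ε)) {n : ℕ} (hn : 1 ≤ n)
    {j : ℕ} (hj : W.J₀ ≤ j) : ENNReal.ofReal (ε ^ 2 * (resolution d j / n)) ≤
      supBiasNR W d α β M C₁ C₂ n j := by
  have h1 := isModelLaw_twoPointLaw (ε := ε) (η := ε) hp hb hpM hbM
    (by rwa [abs_of_pos hε]) (by rwa [abs_of_pos hε])
  have h2 := isModelLaw_twoPointLaw (ε := ε) (η := -ε) hp hb hpM hbM
    (by rwa [abs_of_pos hε]) (by rwa [abs_neg, abs_of_pos hε])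
  have e1 := integral_psiNR_sub_twoPointLaw hn hp hb h1.2 hj
  have e2 := integral_psiNR_sub_twoPointLaw hn hp hb h2.2 hj
  have b1 := h1.1.ofReal_abs_bias_le n j
  have b2 := h2.1.ofReal_abs_bias_le n j
  rw [e1] at b1
  rw [e2] at b2
  set X := (∫ x in cube d, p x * b x * (1 - W.kernel j x x / n)) -
        (1 - 1 / n) * ∑ m, W.scalingCoeff j p m * W.scalingCoeff j b m
  by_cases hX : 0 ≤ X
  · refine (ENNReal.ofReal_le_ofReal ?_).trans b2
    refine le_trans ?_ (le_abs_self _)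
    linarith
  · refine (ENNReal.ofReal_le_ofReal ?_).trans b1
    refine le_trans ?_ (neg_le_abs _)
    linarith

lemma integral_perturbed_mul {p b f g w : (Fin d → ℝ) → ℝ} (hp : ContinuousOn p (cube d))
    (hb : ContinuousOn b (cube d)) (hf : Continuous f) (hg : Continuous g) (hw : Continuous w)
    (s t : ℝ) : ∫ x in cube d, (p x + s * f x) * (b x + t * g x) * w x =
      (∫ x in cube d, p x * b x * w x) + s * (∫ x in cube d, f x * b x * w x) +
        t * (∫ x in cube d, p x * g x * w x) + s * t * ∫ x in cube d, f x * g x * w x := by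
  simp_rw [← integral_const_mul]
  rw [← integral_add (ContinuousOn.integrableOn_cube (by fun_prop))
      (ContinuousOn.integrableOn_cube (by fun_prop)),
    ← integral_add (ContinuousOn.integrableOn_cube (by fun_prop))
      (ContinuousOn.integrableOn_cube (by fun_prop)),
    ← integral_add (ContinuousOn.integrableOn_cube (by fun_prop))
      (ContinuousOn.integrableOn_cube (by fun_prop))]
  exact integral_congr_ae (ae_of_all _ fun x => by ring)

lemma CDVBasis.scalingCoeff_add_mul_waveletSum (hd : 1 ≤ d) {p : (Fin d → ℝ) → ℝ}
    (hp : ContinuousOn p (cube d)) (s : ℝ) {j : ℕ} (hj : W.J₀ ≤ j) (m : Fin d → Fin (2 ^ j)) :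
    W.scalingCoeff j (fun x => p x + s * W.waveletSum d j x) m = W.scalingCoeff j p m := by
  have h0 := W.scalingCoeff_waveletSum hd hj le_rfl m
  simp only [scalingCoeff, add_mul, mul_assoc] at h0 ⊢
  rw [integral_add (ContinuousOn.integrableOn_cube (by fun_prop))
    (ContinuousOn.integrableOn_cube (by fun_prop)), integral_const_mul, h0]
  ring

/-- Perturbing both regression functions by `±` the sum of the wavelets of level `j`, invisible to
the projection kernel, changes the bias, in the mean over the signs weighted by their product, by
the inner product of the perturbations. -/
lemma ofReal_mul_pow_le_supBiasNR (hd : 1 ≤ d) {ε τ M₀ A : ℝ} (hτ : 0 < τ)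
    (hM₀ : 0 ≤ M₀) (hM₀τ : M₀ + τ ≤ M) (hα : 0 < α) (hβ : 0 < β) {p b : (Fin d → ℝ) → ℝ}
    (hp : Measurable p) (hb : Measurable b) (hpM : p ∈ W.holderBall d α M₀)
    (hbM : b ∈ W.holderBall d β M₀)
    (hpC : ∀ᵐ x ∂volume.restrict (cube d), p x ∈ Icc (C₁ + ε) (C₂ - ε))
    (hbC : ∀ᵐ x ∂volume.restrict (cube d), b x ∈ Icc (C₁ + ε) (C₂ - ε)) (hA : 0 ≤ A)
    (hτA : τ * A ≤ ε) {n : ℕ} (hn : 1 ≤ n) {j : ℕ} (hj : W.J₀ ≤ j)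
    (hΨ : ∀ x ∈ cube d,
      ∑ m, |W.Psi (fun _ => true) j m x| ≤ A * (2 : ℝ) ^ ((j : ℝ) * (d / 2)))
    (hK : ∀ x ∈ cube d, W.kernel j x x / n ≤ 1 / 2) :
    ENNReal.ofReal (τ ^ 2 / 2 * ((2 : ℝ) ^ (-(α + β))) ^ j) ≤ supBiasNR W d α β M C₁ C₂ n j := by
  set u := W.waveletSum d j
  have hu : Continuous u := W.continuous_waveletSum d j
  let a : ℝ → ℝ := fun γ => τ * (2 : ℝ) ^ (-((j : ℝ) * (γ + d / 2)))
  have hapos : ∀ γ, 0 < a γ := fun γ => by positivity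
  have hball : ∀ {γ : ℝ} {q : (Fin d → ℝ) → ℝ} {s : ℝ}, |s| = 1 → q ∈ W.holderBall d γ M₀ →
      (fun x => q x + s * a γ * u x) ∈ W.holderBall d γ M := fun {γ q s} hs hq => by
    refine W.holderBall_mono hM₀τ (W.add_mem_holderBall hM₀ hτ.le hq
      (W.smul_waveletSum_mem_holderBall hd hj γ ?_))
    rw [abs_mul, hs, one_mul, abs_of_pos (hapos γ), mul_assoc, ← Real.rpow_add two_pos]
    simp
  have hau : ∀ {γ : ℝ}, 0 < γ → ∀ x ∈ cube d, a γ * |u x| ≤ ε := fun {γ} hγ x hx => by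
    calc a γ * |u x| ≤ a γ * (A * (2 : ℝ) ^ ((j : ℝ) * (d / 2))) :=
          mul_le_mul_of_nonneg_left (W.abs_waveletSum_le (hΨ x hx)) (hapos γ).le
      _ = τ * A * ((2 : ℝ) ^ (-((j : ℝ) * (γ + d / 2))) * (2 : ℝ) ^ ((j : ℝ) * (d / 2))) := by
          simp only [a]; ring
      _ ≤ τ * A * 1 := by
          refine mul_le_mul_of_nonneg_left ?_ (by positivity)
          rw [← Real.rpow_add two_pos]
          refine Real.rpow_le_one_of_one_le_of_nonpos one_le_two ?_
          have : 0 ≤ (j : ℝ) * γ := by positivity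
          linarith
      _ ≤ ε := by linarith
  have hIcc : ∀ {γ : ℝ} {q : (Fin d → ℝ) → ℝ} {s : ℝ}, 0 < γ → |s| = 1 →
      (∀ᵐ x ∂volume.restrict (cube d), q x ∈ Icc (C₁ + ε) (C₂ - ε)) →
      ∀ᵐ x ∂volume.restrict (cube d), q x + s * a γ * u x ∈ Icc (C₁ + |(0 : ℝ)|) (C₂ - |(0 : ℝ)|) :=
    fun {γ q s} hγ hs hq => by
    filter_upwards [hq, ae_restrict_mem (measurableSet_cube d)] with x hx hxc
    have h1 : |s * a γ * u x| ≤ ε := by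
      rw [abs_mul, abs_mul, hs, one_mul, abs_of_pos (hapos γ)]; exact hau hγ x hxc
    have h2 := abs_le.mp h1
    rw [abs_zero]
    constructor <;> linarith [hx.1, hx.2, h2.1, h2.2]
  let w : (Fin d → ℝ) → ℝ := fun x => 1 - W.kernel j x x / n
  have hw : Continuous w := by
    have : Continuous fun x : Fin d → ℝ => W.kernel j x x := by fun_prop
    fun_prop
  have hbias : ∀ s t : ℝ, |s| = 1 → |t| = 1 → ENNReal.ofReal
      |(∫ x in cube d, p x * b x * w x) + s * a α * (∫ x in cube d, u x * b x * w x) +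
        t * a β * (∫ x in cube d, p x * u x * w x) + s * a α * (t * a β) *
          (∫ x in cube d, u x * u x * w x) -
        (1 - 1 / n) * ∑ m, W.scalingCoeff j p m * W.scalingCoeff j b m| ≤
      supBiasNR W d α β M C₁ C₂ n j := by
    intro s t hs ht
    have hpm : Measurable fun x => p x + s * a α * u x := hp.add (hu.measurable.const_mul _)
    have hbm : Measurable fun x => b x + t * a β * u x := hb.add (hu.measurable.const_mul _)
    have hlaw := isModelLaw_twoPointLaw (ε := 0) (η := 0) hpm hbm (hball hs hpM) (hball ht hbM)
      (hIcc hα hs hpC) (hIcc hβ ht hbC)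
    have h := hlaw.1.ofReal_abs_bias_le n j
    rw [integral_psiNR_sub_twoPointLaw hn hpm hbm hlaw.2 hj] at h
    simp_rw [u, CDVBasis.scalingCoeff_add_mul_waveletSum hd hpM.1 _ hj,
      CDVBasis.scalingCoeff_add_mul_waveletSum hd hbM.1 _ hj] at h
    rw [integral_perturbed_mul hpM.1 hbM.1 hu hu hw] at h
    simpa only [zero_mul, sub_zero] using h
  have hquad : resolution d j / 2 ≤ ∫ x in cube d, u x * u x * w x := by
    rw [← W.integral_waveletSum_sq hj, ← integral_div]
    refine setIntegral_mono_on (ContinuousOn.integrableOn_cube (by fun_prop))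
      (ContinuousOn.integrableOn_cube (by fun_prop)) (measurableSet_cube d) fun x hx => ?_
    have h1 : 1 / 2 ≤ w x := by have := hK x hx; simp only [w]; linarith
    calc u x * u x / 2 = u x * u x * (1 / 2) := by ring
      _ ≤ _ := mul_le_mul_of_nonneg_left h1 (mul_self_nonneg _)
  have hrate : τ ^ 2 / 2 * ((2 : ℝ) ^ (-(α + β))) ^ j = a α * a β * (resolution d j / 2) := by
    rw [← CDVBasis.two_rpow_mul_half_mul_self,
      ← Real.rpow_natCast ((2 : ℝ) ^ (-(α + β))), ← Real.rpow_mul two_pos.le]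
    have : (2 : ℝ) ^ (-(α + β) * (j : ℝ)) = (2 : ℝ) ^ (-((j : ℝ) * (α + d / 2))) *
        (2 : ℝ) ^ (-((j : ℝ) * (β + d / 2))) *
        ((2 : ℝ) ^ ((j : ℝ) * (d / 2)) * (2 : ℝ) ^ ((j : ℝ) * (d / 2))) := by
      rw [← Real.rpow_add two_pos, ← Real.rpow_add two_pos, ← Real.rpow_add two_pos]
      congr 1; ring
    rw [this]
    simp only [a]
    ring
  have hmain := mul_le_mul_of_nonneg_left hquad (mul_pos (hapos α) (hapos β)).le
  rw [← hrate] at hmain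
  -- If all four biases were smaller than the mean over the signs, so would be the mean.
  by_contra hlt
  have hb' : ∀ s t : ℝ, |s| = 1 → |t| = 1 →
      |(∫ x in cube d, p x * b x * w x) + s * a α * (∫ x in cube d, u x * b x * w x) +
        t * a β * (∫ x in cube d, p x * u x * w x) + s * a α * (t * a β) *
          (∫ x in cube d, u x * u x * w x) -
        (1 - 1 / n) * ∑ m, W.scalingCoeff j p m * W.scalingCoeff j b m| <
      τ ^ 2 / 2 * ((2 : ℝ) ^ (-(α + β))) ^ j := fun s t hs ht =>
    (ENNReal.ofReal_lt_ofReal_iff (by positivity)).mp ((hbias s t hs ht).trans_lt (not_le.mp hlt))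
  have k1 := (abs_lt.mp (hb' 1 1 (by simp) (by simp))).2
  have k2 := (abs_lt.mp (hb' 1 (-1) (by simp) (by simp))).1
  have k3 := (abs_lt.mp (hb' (-1) 1 (by simp) (by simp))).1
  have k4 := (abs_lt.mp (hb' (-1) (-1) (by simp) (by simp))).2
  linarith

end Bounds

theorem theorem5 {S d : ℕ} (W : CDVBasis S) (hd : 1 ≤ d) (α β M C₁ C₂ : ℝ)
    (hα : 0 < α) (hβ : 0 < β) (hαS : α < S) (hβS : β < S) (hM : 0 < M) :
    (∃ C : ℝ, 0 < C ∧ ∀ n : ℕ, 1 ≤ n → ∀ j : ℕ, W.J₀ ≤ j →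
      (∀ P : Measure (Obs d), IsModelLaw W α β M C₁ C₂ P →
        MemLp (fun D => psiNR W j D) 2 (sampleLaw n P)) ∧
      supBiasNR W d α β M C₁ C₂ n j ≤ ENNReal.ofReal (C * biasRate d α β n j) ∧
      supVarNR W d α β M C₁ C₂ n j ≤ ENNReal.ofReal (C * varRate d n j)) ∧
    ((∃ C₁' C₂' M' : ℝ, C₁ < C₁' ∧ C₂' < C₂ ∧ M' < M ∧
        ∃ P : Measure (Obs d), IsModelLaw W α β M' C₁' C₂' P) →
      ∃ c : ℝ, 0 < c ∧ ∀ n : ℕ, 1 ≤ n → ∀ j : ℕ, W.J₀ ≤ j →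
        ENNReal.ofReal (c * biasRate d α β n j) ≤ supBiasNR W d α β M C₁ C₂ n j) := by
  constructor
  · have hS : 0 < S := by exact_mod_cast hα.trans hαS
    obtain ⟨C, hC, hbias⟩ := exists_abs_bias_le W hS hd hα hβ hM.le C₁ C₂
    obtain ⟨V, hV, hvar⟩ := exists_variance_psiNR_le W d (max |C₁| |C₂|)
    refine ⟨max C V, lt_max_of_lt_left hC, fun n hn j hj => ⟨fun P hP => ?_, ?_, ?_⟩⟩
    · obtain ⟨p, -, b, -, h⟩ := hP.exists_regressionLaw
      exact h.memLp_psiNR W hn j 2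
    · refine iSup₂_le fun P hP => ENNReal.ofReal_le_ofReal ((hbias n hn j hj P hP).trans ?_)
      refine mul_le_mul_of_nonneg_right (le_max_left _ _) (le_max_of_le_right ?_)
      exact div_nonneg (resolution_pos d j).le n.cast_nonneg
    · refine iSup₂_le fun P hP => ?_
      obtain ⟨p, -, b, -, h⟩ := hP.exists_regressionLaw
      have := h.isProbabilityMeasure
      have : IsProbabilityMeasure (sampleLaw n P) := by unfold sampleLaw; infer_instance
      rw [← (h.memLp_psiNR W hn j 2).ofReal_variance_eq]
      refine ENNReal.ofReal_le_ofReal ((hvar P p b h n hn j).trans ?_)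
      refine mul_le_mul_of_nonneg_right (le_max_right _ _) ?_
      unfold varRate resolution
      positivity
  · rintro ⟨C₁', C₂', M', hC₁, hC₂, hM', P, hP⟩
    obtain ⟨ε, τ, M₀, hε, hτ, hM₀, hM₀τ, p, b, hp, hb, hpM, hbM, hpC, hbC⟩ :=
      exists_interior_regressions hM hC₁ hC₂ hM' hP
    obtain ⟨A, hA, hΨ⟩ := W.exists_sum_abs_Psi_le d
    obtain ⟨B, hB, hK⟩ := W.exists_abs_kernel_le d
    have hA0 : 0 < A := by linarith
    -- The size of the perturbations: small enough for both the Hölder norm and the range.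
    set σ := min τ (ε / A)
    have hσ : 0 < σ := lt_min hτ (by positivity)
    have hσA : σ * A ≤ ε := by
      calc σ * A ≤ ε / A * A := mul_le_mul_of_nonneg_right (min_le_right _ _) hA0.le
        _ = ε := by field_simp
    refine ⟨min (ε ^ 2 / (2 * B)) (σ ^ 2 / 2), lt_min (by positivity) (by positivity),
      fun n hn j hj => ?_⟩
    have hn0 : (0 : ℝ) < n := by exact_mod_cast hn
    have hk := resolution_pos d j
    have hM₀M : M₀ ≤ M := by linarith
    have hdiv := ofReal_mul_resolution_div_le_supBiasNR hε hp hb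
      (W.holderBall_mono hM₀M hpM) (W.holderBall_mono hM₀M hbM) hpC hbC hn hj
    have hr1 : ((2 : ℝ) ^ (-(α + β))) ^ j ≤ 1 := by
      refine pow_le_one₀ (by positivity) ?_
      exact Real.rpow_le_one_of_one_le_of_nonpos one_le_two (by linarith)
    have hr0 : 0 ≤ resolution d j / n := by positivity
    have hB0 : 0 < B := by linarith
    have hsmall : ε ^ 2 / (2 * B) * (resolution d j / n) ≤ ε ^ 2 * (resolution d j / n) :=
      mul_le_mul_of_nonneg_right (div_le_self (by positivity) (by linarith)) hr0
    rw [biasRate, resolution_rpow hd]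
    rcases le_total (((2 : ℝ) ^ (-(α + β))) ^ j) (resolution d j / n) with hle | hle
    · rw [max_eq_right hle]
      refine (ENNReal.ofReal_le_ofReal ?_).trans hdiv
      exact (mul_le_mul_of_nonneg_right (min_le_left _ _) hr0).trans hsmall
    · rw [max_eq_left hle]
      -- For `k / n` above a constant the second term of the rate dominates.
      by_cases hc : B * (resolution d j / n) ≤ 1 / 2
      · refine (ENNReal.ofReal_le_ofReal ?_).trans (ofReal_mul_pow_le_supBiasNR hd hσ hM₀
          (by linarith [min_le_left τ (ε / A)]) hα hβ hp hb hpM hbM hpC hbC hA0.le hσA hn hj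
          (hΨ _ j) fun x hx => ?_)
        · exact mul_le_mul_of_nonneg_right (min_le_right _ _) (by positivity)
        · refine le_trans ?_ hc
          rw [← mul_div_assoc]
          exact div_le_div_of_nonneg_right ((le_abs_self _).trans (hK j x hx x hx)) hn0.le
      · refine (ENNReal.ofReal_le_ofReal ?_).trans hdiv
        have hc := not_le.mp hc
        calc _ ≤ ε ^ 2 / (2 * B) * ((2 : ℝ) ^ (-(α + β))) ^ j :=
              mul_le_mul_of_nonneg_right (min_le_left _ _) (by positivity)
          _ ≤ ε ^ 2 / (2 * B) * (2 * (B * (resolution d j / n))) :=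
              mul_le_mul_of_nonneg_left (by linarith) (by positivity)
          _ = _ := by field_simp
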